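/- Let $G$ be a Garside group of finite type with positive monoid $P$ and Garside element $\Delta$: $P\cap P^{-1}=\{1\}$; $\Delta\in P$ and $\Delta^{-1}P\Delta=P$; the prefix order ($x\preccurlyeq y$ iff $x^{-1}y\in P$) is a lattice order on $G$ with meet $\wedge$; the number of factors in factorizations of any given element of $P$ into non-trivial elements of $P$ is bounded; and the set of simple elements (the $s\in P$ with $s^{-1}\Delta\in P$ and $\Delta s^{-1}\in P$) is finite and generates $G$. Put $\inf(x)=\max\{r\in\mathbb Z:\Delta^r\preccurlyeq x\}$ and $\sup(x)=\min\{s\in\mathbb Z: x\preccurlyeq\Delta^s\}$ (both $0$ if $G$ is trivial). Call $y\in G$ absorbable if $\inf(y)=0$ or $\sup(y)=0$, and there is $x\in G$ with $\inf(xy)=\inf(x)$ and $\sup(xy)=\sup(x)$. The additional length complex $\mathcal C_{AL}$ is the graph whose vertices are the cosets $v=g\Delta^{\mathbb Z}$ in $G/\langle\Delta\rangle$; write $\underline v$ for the representative of $v$ with infimum $0$. Two distinct vertices $v,w$ are joined by an edge if $\underline v\,m\in w$ for some simple $m\neq 1,\Delta$ or for some absorbable $m$ (a symmetric relation). Each edge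 has length $1$. For vertices $v,w$, let $x_1\cdots x_r$ be the left normal form of the representative of infimum $0$ of $\underline v^{-1}\underline w\,\Delta^{\mathbb Z}$: each $x_i$ is simple, $x_i\ne 1,\Delta$, and $(x_i^{-1}\Delta)\wedge x_{i+1}=1$ for $1\le i<r$. The preferred path $A(v,w)$ is the edge path with successive vertices $\underline v\,x_1\cdots x_i\,\Delta^{\mathbb Z}$, $0\le i\le r$. Theorem. For every Garside group $(G,P,\Delta)$ of finite type, the graph $\mathcal C_{AL}$ is connected and $60$-hyperbolic: in each geodesic triangle, every side lies in the $60$-neighbourhood of the union of the other two sides. For all vertices $v,w$, the Hausdorff distance between $A(v,w)$ and any geodesic from $v$ to $w$ is at most $39$. Moreover, the paths $A(v,w)$ are uniform unparametrized quasi-geodesics: there are constants $K\ge1$, $C\ge0$, independent of $(G,P,\Delta)$, $v$ and $w$, such that, if $p_0,\dots,p_n$ are the successive vertices of $A(v,w)$, there are indices $0=\rho_0\le\rho_1\le\dots\le\rho_N=n$ for which $\frac{|i-j|}{K}-C\le d(p_{\rho_i},p_{\rho_j})\le K|i-j|+C$ for all $i,j$, and each set $\{p_s:\rho_i\le s\le\rho_{i+1}\}$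 has diameter at most $C$. -/

import Mathlib

/-! ### Connected graphs as metric spaces with edges of length one, and hyperbolicity -/

namespace MetricGraph

/-- A point of the geometric realization of a simple graph `Γ`, in coordinates: the point of the
edge from `a` to `b` at distance `t` from `a` and `1 - t` from `b`. The vertex `v` is also given
the coordinates `(v, v, 0)`. Different coordinates of one point are at distance `0` below. -/
structure Point {V : Type*} (Γ : SimpleGraph V) where
  a : V
  b : V
  t : ℝ
  t_nonneg : 0 ≤ t
  t_le_one : t ≤ 1
  adj_or_vertex : Γ.Adj a b ∨ (a = b ∧ t = 0)

variable {V : Type*} {Γ : SimpleGraph V}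

/-- The vertex `v`, as a point of the geometric realization. -/
def vertex (Γ : SimpleGraph V) (v : V) : Point Γ := ⟨v, v, 0, le_rfl, zero_le_one, Or.inr ⟨rfl, rfl⟩⟩

/-- Length of a shortest route from `p` to `q` which leaves the edge of `p` through one of its ends
and enters the edge of `q` through one of its ends. -/
noncomputable def distThroughEnds (p q : Point Γ) : ℝ :=
  min (min (p.t + Γ.dist p.a q.a + q.t) (p.t + Γ.dist p.a q.b + (1 - q.t)))
    (min ((1 - p.t) + Γ.dist p.b q.a + q.t) ((1 - p.t) + Γ.dist p.b q.b + (1 - q.t)))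

open Classical in
/-- The path metric of the geometric realization of a connected graph in which each edge has
length `1`: for two points on a common edge there is also the route inside this edge. -/
noncomputable def pointDist (p q : Point Γ) : ℝ :=
  if p.a = q.a ∧ p.b = q.b then min (distThroughEnds p q) |p.t - q.t|
  else if p.a = q.b ∧ p.b = q.a then min (distThroughEnds p q) |p.t - (1 - q.t)|
  else distThroughEnds p q

/-- `S` is (the image of) a geodesic from `p` to `q`: an isometrically embedded interval. -/
def IsGeodesicSegment (S : Set (Point Γ)) (p q : Point Γ) : Prop :=
  ∃ (L : ℝ) (γ : ℝ → Point Γ), 0 ≤ L ∧ γ 0 = p ∧ γ L = q ∧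
    (∀ s ∈ Set.Icc 0 L, ∀ t ∈ Set.Icc 0 L, pointDist (γ s) (γ t) = |s - t|) ∧
    S = γ '' Set.Icc 0 L

/-- Every point of `S` is at distance at most `δ` from some point of `T`. -/
def IsInNeighborhood (δ : ℝ) (S T : Set (Point Γ)) : Prop :=
  ∀ x ∈ S, ∃ y ∈ T, pointDist x y ≤ δ

/-- The graph `Γ` is connected and, with edges of length `1`, it is a `δ`-hyperbolic geodesic
space: each side of a geodesic triangle (with any three points of the realization as its corners)
is contained in the `δ`-neighbourhood of the union of the two other sides. -/
def IsHyperbolic (Γ : SimpleGraph V) (δ : ℝ) : Prop :=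
  Γ.Connected ∧ ∀ (p q r : Point Γ) (S₁ S₂ S₃ : Set (Point Γ)),
    IsGeodesicSegment S₁ p q → IsGeodesicSegment S₂ q r → IsGeodesicSegment S₃ p r →
      IsInNeighborhood δ S₁ (S₂ ∪ S₃)

/-- The set of points of the edge path with successive vertices `f 0, …, f n`. -/
def pathPoints (Γ : SimpleGraph V) (f : ℕ → V) (n : ℕ) : Set (Point Γ) :=
  {p | (∃ i ≤ n, p = vertex Γ (f i)) ∨ ∃ i < n, p.a = f i ∧ p.b = f (i + 1)}

/-- The edge path `f 0, …, f n` is an unparametrized `(K, C)`-quasi-geodesic: there are stopping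
times `0 = ρ 0 ≤ … ≤ ρ N = n` such that `i ↦ f (ρ i)` is a `(K, C)`-quasi-geodesic, while the path
stays in a set of diameter at most `C` between consecutive stopping times. -/
def IsUnparametrizedQuasiGeodesic (Γ : SimpleGraph V) (K C : ℝ) (f : ℕ → V) (n : ℕ) : Prop :=
  ∃ (N : ℕ) (ρ : ℕ → ℕ), ρ 0 = 0 ∧ ρ N = n ∧ (∀ i < N, ρ i ≤ ρ (i + 1)) ∧
    (∀ i ≤ N, ∀ j ≤ N, |(i : ℝ) - j| / K - C ≤ Γ.dist (f (ρ i)) (f (ρ j)) ∧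
      (Γ.dist (f (ρ i)) (f (ρ j)) : ℝ) ≤ K * |(i : ℝ) - j| + C) ∧
    ∀ i < N, ∀ s ∈ Set.Icc (ρ i) (ρ (i + 1)), ∀ t ∈ Set.Icc (ρ i) (ρ (i + 1)),
      (Γ.dist (f s) (f t) : ℝ) ≤ C

end MetricGraph

/-! ### Garside groups and the additional length complex -/

namespace Garside

variable {G : Type*} [Group G]

/-- The prefix order `x ≼ y` of `G` with respect to the positive monoid `P`. -/
def Prefix (P : Submonoid G) (x y : G) : Prop := x⁻¹ * y ∈ P

/-- `d = x ∧ y`, the greatest common divisor for the prefix order. -/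
def IsGcd (P : Submonoid G) (x y d : G) : Prop :=
  Prefix P d x ∧ Prefix P d y ∧ ∀ c, Prefix P c x → Prefix P c y → Prefix P c d

/-- `m = x ∨ y`, the least common multiple for the prefix order. -/
def IsLcm (P : Submonoid G) (x y m : G) : Prop :=
  Prefix P x m ∧ Prefix P y m ∧ ∀ c, Prefix P x c → Prefix P y c → Prefix P m c

/-- Simple elements: the positive left and right divisors of `Δ`. -/
def IsSimple (P : Submonoid G) (Δ s : G) : Prop := s ∈ P ∧ s⁻¹ * Δ ∈ P ∧ Δ * s⁻¹ ∈ P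

/-- `(G, P, Δ)` is a Garside group of finite type, with positive monoid `P` and Garside
element `Δ`. -/
structure IsGarsideGroup (P : Submonoid G) (Δ : G) : Prop where
  eq_one_of_inv_mem : ∀ x ∈ P, x⁻¹ ∈ P → x = 1
  delta_mem : Δ ∈ P
  exists_gcd : ∀ x y : G, ∃ d, IsGcd P x y d
  exists_lcm : ∀ x y : G, ∃ m, IsLcm P x y m
  closure_simple : Subgroup.closure {s | IsSimple P Δ s} = ⊤
  conj_mem_iff : ∀ x : G, Δ⁻¹ * x * Δ ∈ P ↔ x ∈ P
  bounded_factorizations : ∀ x ∈ P, ∃ N : ℕ, ∀ l : List G,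
    (∀ a ∈ l, a ∈ P ∧ a ≠ 1) → l.prod = x → l.length ≤ N
  finite_simple : {s | IsSimple P Δ s}.Finite

/-- The infimum `max {r ∈ ℤ | Δ ^ r ≼ x}` (the maximum exists unless `G` is trivial, and then this
is `0`). -/
noncomputable def inf (P : Submonoid G) (Δ x : G) : ℤ := sSup {r : ℤ | Prefix P (Δ ^ r) x}

/-- The supremum `min {s ∈ ℤ | x ≼ Δ ^ s}` (the minimum exists unless `G` is trivial, and then this
is `0`). -/
noncomputable def sup (P : Submonoid G) (Δ x : G) : ℤ := sInf {s : ℤ | Prefix P x (Δ ^ s)}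

/-- Absorbable elements. -/
def IsAbsorbable (P : Submonoid G) (Δ y : G) : Prop :=
  (inf P Δ y = 0 ∨ sup P Δ y = 0) ∧
    ∃ x : G, inf P Δ (x * y) = inf P Δ x ∧ sup P Δ (x * y) = sup P Δ x

/-- The pair `(s, t)` of simple elements is left-weighted: `∂s ∧ t = 1`, where `∂s = s⁻¹ Δ`. -/
def LeftWeighted (P : Submonoid G) (Δ s t : G) : Prop := IsGcd P (s⁻¹ * Δ) t 1

/-- `x₁ ⋯ xᵣ` is the left normal form of the element `x` of infimum `0`. -/
def IsLeftNormalForm (P : Submonoid G) (Δ x : G) (l : List G) : Prop :=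
  (∀ s ∈ l, IsSimple P Δ s ∧ s ≠ 1 ∧ s ≠ Δ) ∧ l.IsChain (LeftWeighted P Δ) ∧ l.prod = x

/-- The list of letters of the left normal form of an element of infimum `0`; in a Garside group
there is exactly one such list. -/
noncomputable def leftNormalForm (P : Submonoid G) (Δ x : G) : List G :=
  Classical.epsilon (IsLeftNormalForm P Δ x)

/-- The vertices of the additional length complex: the cosets `g Δ^ℤ`. -/
abbrev Vertex (Δ : G) : Type _ := G ⧸ Subgroup.zpowers Δ

/-- The coset `g Δ^ℤ`. -/
def coset (Δ g : G) : Vertex Δ := QuotientGroup.mk g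

/-- The distinguished representative of `v`, that is, its representative of infimum `0`. -/
noncomputable def rep (P : Submonoid G) (Δ : G) (v : Vertex Δ) : G :=
  v.out * Δ ^ (-inf P Δ v.out)

theorem coset_rep (P : Submonoid G) (Δ : G) (v : Vertex Δ) : coset Δ (rep P Δ v) = v := by
  have h : coset Δ (rep P Δ v) = QuotientGroup.mk v.out :=
    (QuotientGroup.mk_mul_of_mem v.out (Subgroup.mem_zpowers_iff.mpr ⟨_, rfl⟩))
  rw [h]; exact v.out_eq'

/-- The additional length complex: distinct vertices `v`, `w` are joined by an edge if
`rep v * m` represents `w` for a simple element `m ≠ 1, Δ` or for an absorbable element `m`.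
(In a Garside group this relation is symmetric.) -/
def additionalLengthComplex (P : Submonoid G) (Δ : G) : SimpleGraph (Vertex Δ) :=
  SimpleGraph.fromRel fun v w =>
    (∃ m, IsSimple P Δ m ∧ m ≠ 1 ∧ m ≠ Δ ∧ coset Δ (rep P Δ v * m) = w) ∨
      ∃ y, IsAbsorbable P Δ y ∧ coset Δ (rep P Δ v * y) = w

/-- The letters of the preferred path `A(v, w)`: the left normal form of the distinguished
representative of `(rep v)⁻¹ (rep w) Δ^ℤ`. -/
noncomputable def preferredWord (P : Submonoid G) (Δ : G) (v w : Vertex Δ) : List G :=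
  leftNormalForm P Δ (rep P Δ (coset Δ ((rep P Δ v)⁻¹ * rep P Δ w)))

/-- The `i`-th vertex of the preferred path `A(v, w)`. -/
noncomputable def preferredVertex (P : Submonoid G) (Δ : G) (v w : Vertex Δ) (i : ℕ) : Vertex Δ :=
  coset Δ (rep P Δ v * ((preferredWord P Δ v w).take i).prod)

/-- The preferred path `A(v, w)`, as a set of points of the additional length complex. -/
def preferredPath (P : Submonoid G) (Δ : G) (v w : Vertex Δ) :
    Set (MetricGraph.Point (additionalLengthComplex P Δ)) :=
  MetricGraph.pathPoints (additionalLengthComplex P Δ) (preferredVertex P Δ v w)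
    (preferredWord P Δ v w).length

end Garside

/-! The proof has a Garside part and a purely metric part, which meet in `IsSlimPathSystem`.

Garside part. The prefix order is invariant under left multiplication by `G` and under right
multiplication by `Δ`. The partial products of a left normal form of `x` are the meets `x ⊓ Δ ^ i`,
so the preferred path from `a Δ^ℤ` to `b Δ^ℤ` consists exactly of the cosets of `b ⊓ a * Δ ^ i`, `i
∈ ℤ` (`mem_pathSet_iff`). This description makes closure under subpaths a lattice identity. It also
reduces slimness of triangles to one statement about three elements (`exists_near_near`): for a
suitable `k`, the coset of `a ⊓ b` is at distance at most `2` from that of `a ⊓ c * Δ ^ k` or of `b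
⊓ c * Δ ^ k`. The edges used there come from absorption: if `p ≤ q` and, seen from some `g`, both
have the same infimum and the same supremum, then `p⁻¹ * q` is absorbable (`near_of_absorb`).

Metric part. This is the "guessing geodesics" argument. Repeated halving of a walk, with `2`-slim
triangles, keeps a path within a logarithm of the length of any walk with the same ends. If a path
went as far as `k` from a geodesic, a detour of length at most `8 * k` would avoid the open `k`-ball
around its farthest vertex; the logarithmic bound then forces `k ≤ 17`. A connectedness argument
gives the reverse inclusion with constant `34`. Slimness of the paths now passes to geodesic
triangles, and distance from the origin is almost monotone along each path, which yields the
quasi-geodesic stopping times. Finally, geodesics of the realization are replaced by geodesic edge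
paths at bounded distance. -/

namespace MetricGraph

/-! ### Slim path systems in a graph: paths versus geodesics -/

section PathSystems

variable {V : Type*} {Γ : SimpleGraph V} {f : V → V → ℕ → V} {len : V → V → ℕ}

/-- The set of vertices of the path from `v` to `w`. -/
def pathSet (f : V → V → ℕ → V) (len : V → V → ℕ) (v w : V) : Set V :=
  {x | ∃ i ≤ len v w, f v w i = x}

/-- A family of edge paths `f v w 0, …, f v w (len v w)` joining `v` to `w` which is closed under
taking subpaths and has `2`-slim triangles. -/
structure IsSlimPathSystem (Γ : SimpleGraph V) (f : V → V → ℕ → V) (len : V → V → ℕ) : Prop where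
  connected : Γ.Connected
  apply_zero : ∀ v w, f v w 0 = v
  apply_len : ∀ v w, f v w (len v w) = w
  dist_succ_le : ∀ v w, ∀ i < len v w, Γ.dist (f v w i) (f v w (i + 1)) ≤ 1
  mem_subpath : ∀ v w i l j, i ≤ l → l ≤ j → j ≤ len v w →
    f v w l ∈ pathSet f len (f v w i) (f v w j)
  slim : ∀ u v w, ∀ x ∈ pathSet f len u w,
    ∃ y ∈ pathSet f len u v ∪ pathSet f len v w, Γ.dist x y ≤ 2
  dist_le_of_dist_le_one : ∀ v w, Γ.dist v w ≤ 1 → ∀ x ∈ pathSet f len v w, Γ.dist v x ≤ 1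

/-- The sequence `u 0, …, u n` is the sequence of vertices of a geodesic edge path. -/
def IsVertexGeodesic (Γ : SimpleGraph V) (u : ℕ → V) (n : ℕ) : Prop :=
  ∀ i j, i ≤ j → j ≤ n → Γ.dist (u i) (u j) = j - i

theorem IsVertexGeodesic.dist_le {u : ℕ → V} {n : ℕ} (hu : IsVertexGeodesic Γ u n) {i j : ℕ}
    (hi : i ≤ n) (hj : j ≤ n) : Γ.dist (u i) (u j) + i = j ∨ Γ.dist (u i) (u j) + j = i := by
  rcases le_total i j with h | h
  · left; rw [hu i j h hj]; omega
  · right; rw [SimpleGraph.dist_comm, hu j i h hi]; omega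

theorem IsVertexGeodesic.reverse {u : ℕ → V} {n : ℕ} (hu : IsVertexGeodesic Γ u n) :
    IsVertexGeodesic Γ (fun i => u (n - i)) n := by
  intro i j hij hj
  rw [SimpleGraph.dist_comm, hu _ _ (by omega) (by omega)]
  omega

/-- There is a walk along each stretch of a geodesic. -/
theorem IsVertexGeodesic.exists_walk {u : ℕ → V} {n : ℕ}
    (hu : IsVertexGeodesic Γ u n) {i j : ℕ} (hi : i ≤ n) (hj : j ≤ n) :
    ∃ p : Γ.Walk (u i) (u j), p.length = Γ.dist (u i) (u j) ∧
      ∀ x ∈ p.support, ∃ l ≤ n, x = u l := by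
  have main : ∀ d i, i + d ≤ n → ∃ p : Γ.Walk (u i) (u (i + d)), p.length = d ∧
      ∀ x ∈ p.support, ∃ l ≤ n, x = u l := by
    intro d
    induction d with
    | zero => intro i hi; exact ⟨.nil, rfl, fun x hx => ⟨i, by omega, by simpa using hx⟩⟩
    | succ d ih =>
      intro i hi
      obtain ⟨p, hp, hs⟩ := ih i (by omega)
      have hadj : Γ.Adj (u (i + d)) (u (i + (d + 1))) := by
        rw [← SimpleGraph.dist_eq_one_iff_adj, hu _ _ (by omega) hi]; omega
      refine ⟨p.concat hadj, by simp [hp], fun x hx => ?_⟩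
      rw [SimpleGraph.Walk.support_concat, List.mem_append] at hx
      rcases hx with hx | hx
      · exact hs x hx
      · exact ⟨_, hi, by simpa using hx⟩
  rcases le_total i j with h | h
  · obtain ⟨d, rfl⟩ := Nat.exists_eq_add_of_le h
    obtain ⟨p, hp, hs⟩ := main d i hj
    exact ⟨p, by rw [hp, hu _ _ h hj]; omega, hs⟩
  · obtain ⟨d, rfl⟩ := Nat.exists_eq_add_of_le h
    obtain ⟨p, hp, hs⟩ := main d j hi
    refine ⟨p.reverse, ?_, fun x hx => hs x (by simpa using hx)⟩
    rw [SimpleGraph.Walk.length_reverse, hp, SimpleGraph.dist_comm, hu _ _ h hi]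
    omega

theorem exists_isVertexGeodesic (hc : Γ.Connected) (v w : V) :
    ∃ u : ℕ → V, IsVertexGeodesic Γ u (Γ.dist v w) ∧ u 0 = v ∧ u (Γ.dist v w) = w := by
  obtain ⟨p, hp⟩ := hc.exists_walk_length_eq_dist v w
  refine ⟨p.getVert, fun i j hij hj => ?_, p.getVert_zero, by rw [← hp, p.getVert_length]⟩
  have h1 : Γ.dist v (p.getVert i) ≤ i :=
    (SimpleGraph.dist_le (p.take i)).trans (by simp)
  have h2 : Γ.dist (p.getVert j) w ≤ p.length - j :=
    (SimpleGraph.dist_le (p.drop j)).trans (by simp)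
  have h3 : Γ.dist (p.getVert i) (p.getVert j) ≤ j - i := by
    have hw := SimpleGraph.dist_le ((p.drop i).take (j - i))
    have hv : (p.drop i).getVert (j - i) = p.getVert j := by
      rw [SimpleGraph.Walk.drop_getVert, Nat.add_sub_cancel' hij]
    rw [← hv]
    exact hw.trans (by simp)
  have h4 := hc.dist_triangle (u := v) (v := p.getVert i) (w := w)
  have h5 := hc.dist_triangle (u := p.getVert i) (v := p.getVert j) (w := w)
  omega

/-- A discrete intermediate value theorem: a sequence that climbs by at most one per step cannot
jump over `c`. -/
theorem exists_first_index {g : ℕ → ℕ} {m c : ℕ} (h0 : g 0 ≤ c)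
    (hs : ∀ i < m, g (i + 1) ≤ g i + 1) (hc : c ≤ g m) :
    ∃ j ≤ m, g j = c ∧ ∀ i < j, g i < c := by
  classical
  have hex : ∃ j, c ≤ g j := ⟨m, hc⟩
  have hle : Nat.find hex ≤ m := Nat.find_min' hex hc
  refine ⟨Nat.find hex, hle, ?_, fun i hi => not_le.1 (Nat.find_min hex hi)⟩
  refine le_antisymm ?_ (Nat.find_spec hex)
  rcases Nat.eq_zero_or_pos (Nat.find hex) with h | h
  · rw [h]; exact h0
  · have h1 := Nat.find_min hex (Nat.sub_lt h one_pos)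
    have h2 := hs (Nat.find hex - 1) (by omega)
    rw [Nat.sub_add_cancel h] at h2
    omega

/-- The bound is sharp: `Nat.clog 2 17 = 5`. For `k ≥ 18` the ceiling `e` of the logarithm is at
least `5`; exponential growth excludes `e ≥ 6`, and `e = 5` is excluded directly. -/
theorem le_seventeen_of_le_clog {k : ℕ} (h : k ≤ 2 * Nat.clog 2 k + 7) : k ≤ 17 := by
  by_contra hk
  have hpow : ∀ e, 6 ≤ e → 2 * e + 7 ≤ 2 ^ (e - 1) := by
    intro e he
    induction e, he using Nat.le_induction with
    | base => norm_num
    | succ e he ih =>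
      have : 2 ^ (e + 1 - 1) = 2 ^ (e - 1) * 2 := by rw [← pow_succ]; congr 1; omega
      omega
  have h1 : 2 ^ (Nat.clog 2 k - 1) < k := Nat.pow_pred_clog_lt_self (by norm_num) (by omega)
  have := hpow (Nat.clog 2 k) (by omega)
  omega

namespace IsSlimPathSystem

/-- Paths stay logarithmically close to walks with the same ends. -/
theorem exists_mem_support_dist_le (hf : IsSlimPathSystem Γ f len) (k : ℕ) :
    ∀ {v w : V} (p : Γ.Walk v w), p.length ≤ 2 ^ k →
    ∀ x ∈ pathSet f len v w, ∃ y ∈ p.support, Γ.dist x y ≤ 2 * k + 1 := by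
  induction k with
  | zero =>
    intro v w p hp x hx
    refine ⟨v, p.start_mem_support, ?_⟩
    rw [SimpleGraph.dist_comm]
    exact hf.dist_le_of_dist_le_one v w ((SimpleGraph.dist_le p).trans hp) x hx
  | succ k ih =>
    intro v w p hp x hx
    rw [pow_succ] at hp
    -- The vertex reached after `2 ^ k` steps serves as third corner, so each halving of the walk
    -- costs the slimness constant `2`.
    obtain ⟨y, hy, hxy⟩ := hf.slim v (p.getVert (2 ^ k)) w x hx
    have hsup := congrArg (fun q => q.support) (p.append_take_drop_eq (2 ^ k))
    have hz : ∃ z ∈ p.support, Γ.dist y z ≤ 2 * k + 1 := by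
      rw [← hsup]
      rcases hy with hy | hy
      · obtain ⟨z, hz, hd⟩ := ih (p.take (2 ^ k)) (by simp) y hy
        exact ⟨z, by rw [SimpleGraph.Walk.mem_support_append_iff]; exact .inl hz, hd⟩
      · obtain ⟨z, hz, hd⟩ := ih (p.drop (2 ^ k)) (by simp; omega) y hy
        exact ⟨z, by rw [SimpleGraph.Walk.mem_support_append_iff]; exact .inr hz, hd⟩
    obtain ⟨z, hz, hd⟩ := hz
    have := hf.connected.dist_triangle (u := x) (v := y) (w := z)
    exact ⟨z, hz, by omega⟩

theorem dist_step_le (hf : IsSlimPathSystem Γ f len) {v w : V} {i : ℕ} (hi : i < len v w) (x : V) :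
    Γ.dist (f v w (i + 1)) x ≤ Γ.dist (f v w i) x + 1 := by
  have h1 := hf.dist_succ_le v w i hi
  have h2 := hf.connected.dist_triangle (u := f v w (i + 1)) (v := f v w i) (w := x)
  rw [SimpleGraph.dist_comm (u := f v w (i + 1)) (v := f v w i)] at h2
  omega

theorem dist_step_le' (hf : IsSlimPathSystem Γ f len) {v w : V} {i : ℕ} (hi : i < len v w) (x : V) :
    Γ.dist (f v w i) x ≤ Γ.dist (f v w (i + 1)) x + 1 := by
  have h1 := hf.dist_succ_le v w i hi
  have h2 := hf.connected.dist_triangle (u := f v w i) (v := f v w (i + 1)) (w := x)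
  omega

/-- Every path is in the `17`-neighbourhood of each geodesic with the same ends. -/
theorem exists_dist_geodesic_le (hf : IsSlimPathSystem Γ f len)
    {u : ℕ → V} {n : ℕ} (hu : IsVertexGeodesic Γ u n) {x : V}
    (hx : x ∈ pathSet f len (u 0) (u n)) : ∃ i ≤ n, Γ.dist x (u i) ≤ 17 := by
  classical
  have tri := fun a b c => hf.connected.dist_triangle (u := a) (v := b) (w := c)
  set F := f (u 0) (u n) with hF
  set m := len (u 0) (u n) with hm
  have hne : (Finset.range (n + 1)).Nonempty := ⟨0, by simp⟩
  set D : V → ℕ := fun y => (Finset.range (n + 1)).inf' hne (fun i => Γ.dist y (u i)) with hD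
  have hDle : ∀ y, ∀ i ≤ n, D y ≤ Γ.dist y (u i) := fun y i hi =>
    Finset.inf'_le _ (Finset.mem_range.2 (by omega))
  have hDex : ∀ y, ∃ i ≤ n, D y = Γ.dist y (u i) := fun y => by
    obtain ⟨i, hi, h⟩ := Finset.exists_mem_eq_inf' hne (fun i => Γ.dist y (u i))
    exact ⟨i, by simpa [Nat.lt_succ_iff] using hi, h⟩
  -- `F l` is a vertex of the path farthest from the geodesic, and `k` is its distance to it.
  obtain ⟨l, hl, hmax⟩ := Finset.exists_max_image (Finset.range (m + 1)) (fun i => D (F i))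
    ⟨0, by simp⟩
  have hlm : l ≤ m := by simpa [Nat.lt_succ_iff] using hl
  set k := D (F l) with hk
  have hDk : ∀ i ≤ m, D (F i) ≤ k := fun i hi => hmax i (by simp; omega)
  suffices hk17 : k ≤ 17 by
    obtain ⟨i, hi, rfl⟩ := hx
    obtain ⟨j, hj, h⟩ := hDex (F i)
    exact ⟨j, hj, h ▸ (hDk i hi).trans hk17⟩
  -- From a vertex at distance `2 * k` from `F l`, a shortest route to the geodesic has length at
  -- most `k`, hence stays at distance at least `k` from `F l`.
  have far : ∀ i ≤ m, Γ.dist (F i) (F l) = 2 * k → ∃ α ≤ n, Γ.dist (F i) (u α) ≤ k ∧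
      ∀ y, Γ.dist (F i) y ≤ Γ.dist (F i) (u α) → k ≤ Γ.dist (F l) y := by
    intro i hi hd
    obtain ⟨α, hα, h⟩ := hDex (F i)
    have := hDk i hi
    refine ⟨α, hα, by omega, fun y hy => ?_⟩
    have h1 := tri (F i) y (F l)
    rw [SimpleGraph.dist_comm (u := y)] at h1
    omega
  have near : ∀ i ≤ m, ∀ α ≤ n, F i = u α → Γ.dist (F i) (u α) ≤ k ∧
      ∀ y, Γ.dist (F i) y ≤ Γ.dist (F i) (u α) → k ≤ Γ.dist (F l) y := by
    intro i hi α hα h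
    rw [h, SimpleGraph.dist_self]
    refine ⟨Nat.zero_le _, fun y hy => ?_⟩
    rw [Nat.le_zero, hf.connected.dist_eq_zero_iff] at hy
    rw [← hy]
    exact hDle _ _ hα
  -- The detour starts at the nearest earlier vertex at distance `2 * k` from `F l`, or at the
  -- origin of the path, which lies on the geodesic; `right` is the mirror image.
  have left : ∃ i ≤ l, Γ.dist (F i) (F l) ≤ 2 * k ∧ ∃ α ≤ n, Γ.dist (F i) (u α) ≤ k ∧
      ∀ y, Γ.dist (F i) y ≤ Γ.dist (F i) (u α) → k ≤ Γ.dist (F l) y := by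
    by_cases h : 2 * k ≤ Γ.dist (F 0) (F l)
    · obtain ⟨j, hj, hd, -⟩ := exists_first_index (g := fun i => Γ.dist (F (l - i)) (F l)) (m := l)
        (c := 2 * k) (by simp) (fun i hi => by
          have := hf.dist_step_le' (v := u 0) (w := u n) (i := l - (i + 1)) (by omega) (F l)
          rwa [show l - (i + 1) + 1 = l - i by omega] at this) (by simpa using h)
      exact ⟨l - j, by omega, hd.le, far _ (by omega) hd⟩
    · exact ⟨0, by omega, by omega, 0, by omega, near 0 (by omega) 0 (by omega)
        (hf.apply_zero _ _)⟩
  have right : ∃ i, l ≤ i ∧ i ≤ m ∧ Γ.dist (F i) (F l) ≤ 2 * k ∧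
      ∃ α ≤ n, Γ.dist (F i) (u α) ≤ k ∧
      ∀ y, Γ.dist (F i) y ≤ Γ.dist (F i) (u α) → k ≤ Γ.dist (F l) y := by
    by_cases h : 2 * k ≤ Γ.dist (F m) (F l)
    · obtain ⟨j, hj, hd, -⟩ := exists_first_index (g := fun i => Γ.dist (F (l + i)) (F l))
        (m := m - l) (c := 2 * k) (by simp) (fun i hi =>
          hf.dist_step_le (v := u 0) (w := u n) (i := l + i) (by omega) (F l))
        (by simpa [Nat.add_sub_cancel' hlm] using h)
      exact ⟨l + j, by omega, by omega, hd.le, far _ (by omega) hd⟩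
    · exact ⟨m, by omega, le_rfl, by omega, n, le_rfl, near m le_rfl n le_rfl (hf.apply_len _ _)⟩
  obtain ⟨i, hi, hil, α, hα, hiα, hifar⟩ := left
  obtain ⟨j, hj, hjm, hjl, β, hβ, hjβ, hjfar⟩ := right
  obtain ⟨p₁, hp₁⟩ := hf.connected.exists_walk_length_eq_dist (F i) (u α)
  obtain ⟨p₂, hp₂, hs₂⟩ := hu.exists_walk hα hβ
  obtain ⟨p₃, hp₃⟩ := hf.connected.exists_walk_length_eq_dist (F j) (u β)
  have hαβ : Γ.dist (u α) (u β) ≤ 6 * k := by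
    have h1 := tri (u α) (F i) (u β)
    have h2 := tri (F i) (F l) (u β)
    have h3 := tri (F l) (F j) (u β)
    rw [SimpleGraph.dist_comm (u := u α) (v := F i)] at h1
    rw [SimpleGraph.dist_comm (u := F l) (v := F j)] at h3
    omega
  have hclog := Nat.le_pow_clog (b := 2) (by norm_num) k
  -- The detour has length at most `k + 6 * k + k = 8 * k ≤ 2 ^ (3 + Nat.clog 2 k)`, and all its
  -- vertices are at distance at least `k` from `F l`.
  obtain ⟨y, hy, hd⟩ := hf.exists_mem_support_dist_le (3 + Nat.clog 2 k)
    (p₁.append (p₂.append p₃.reverse)) (by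
      rw [pow_add]
      simp only [SimpleGraph.Walk.length_append, SimpleGraph.Walk.length_reverse]
      omega) (F l) (hf.mem_subpath _ _ i l j hi hj hjm)
  refine le_seventeen_of_le_clog (le_trans ?_ (hd.trans (by omega)))
  rw [SimpleGraph.Walk.mem_support_append_iff, SimpleGraph.Walk.mem_support_append_iff,
    SimpleGraph.Walk.support_reverse, List.mem_reverse] at hy
  rcases hy with hy | hy | hy
  · refine hifar y ?_
    rw [← hp₁]
    exact (SimpleGraph.dist_le (p₁.takeUntil y hy)).trans (p₁.length_takeUntil_le_length hy)
  · obtain ⟨t, ht, rfl⟩ := hs₂ y hy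
    exact hDle _ _ ht
  · refine hjfar y ?_
    rw [← hp₃]
    exact (SimpleGraph.dist_le (p₃.takeUntil y hy)).trans (p₃.length_takeUntil_le_length hy)

/-- Every geodesic is in the `34`-neighbourhood of the path with the same ends. -/
theorem exists_dist_path_le (hf : IsSlimPathSystem Γ f len)
    {u : ℕ → V} {n : ℕ} (hu : IsVertexGeodesic Γ u n) {i : ℕ}
    (hi : i ≤ n) : ∃ x ∈ pathSet f len (u 0) (u n), Γ.dist (u i) x ≤ 34 := by
  classical
  have tri := fun a b c => hf.connected.dist_triangle (u := a) (v := b) (w := c)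
  set F := f (u 0) (u n) with hF
  set m := len (u 0) (u n) with hm
  by_contra! hcon
  have hfar : ∀ j ≤ m, 34 < Γ.dist (u i) (F j) := fun j hj => hcon _ ⟨j, hj, rfl⟩
  -- The shadow of the path on the geodesic stays before `u i`. A shadow of `F j` is at distance at
  -- least `18` from `u i`, so crossing would need a jump of at least `36`, while consecutive
  -- shadows are at most `17 + 1 + 17 = 35` apart. At the end of the path this is absurd.
  have hP : ∀ j ≤ m, ∃ l, l + 17 < i ∧ Γ.dist (F j) (u l) ≤ 17 := by
    intro j
    induction j with
    | zero =>
      intro _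
      have h0 : F 0 = u 0 := hf.apply_zero _ _
      have h1 := hfar 0 (Nat.zero_le _)
      rw [h0, SimpleGraph.dist_comm, hu 0 i (Nat.zero_le _) hi] at h1
      exact ⟨0, by omega, by rw [h0]; simp⟩
    | succ j ih =>
      intro hj
      obtain ⟨l, hl, hd⟩ := ih (by omega)
      obtain ⟨l', hl', hd'⟩ := hf.exists_dist_geodesic_le hu (x := F (j + 1)) ⟨j + 1, hj, rfl⟩
      refine ⟨l', ?_, hd'⟩
      have h1 := tri (u l) (F j) (u l')
      have h2 := hf.dist_step_le' (v := u 0) (w := u n) (i := j) (by omega) (u l')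
      have h3 := tri (u i) (u l') (F (j + 1))
      have h4 := hfar (j + 1) hj
      rw [SimpleGraph.dist_comm (u := u l') (v := F (j + 1))] at h3
      have h5 := hu.dist_le (i := l) (j := l') (by omega) hl'
      have h6 := hu.dist_le (i := i) (j := l') hi hl'
      change Γ.dist (F j) (u l') ≤ Γ.dist (F (j + 1)) (u l') + 1 at h2
      rw [SimpleGraph.dist_comm (u := F j) (v := u l)] at hd
      omega
  obtain ⟨l, hl, hd⟩ := hP m le_rfl
  have hlast : F m = u n := hf.apply_len _ _
  have h1 := hfar m le_rfl
  rw [hlast, SimpleGraph.dist_comm] at hd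
  rw [hlast] at h1
  rw [hu l n (by omega) le_rfl] at hd
  rw [hu i n hi le_rfl] at h1
  omega

/-- Along a path, distances are differences of distances from the origin, up to `34`. -/
theorem dist_path_le (hf : IsSlimPathSystem Γ f len)
    {v w : V} {i j : ℕ} (hij : i ≤ j) (hj : j ≤ len v w) :
    Γ.dist (f v w i) (f v w j) + Γ.dist v (f v w i) ≤ Γ.dist v (f v w j) + 34 := by
  obtain ⟨u, hu, h0, hn⟩ := exists_isVertexGeodesic hf.connected v (f v w j)
  have hmem := hf.mem_subpath v w 0 i j (Nat.zero_le _) hij hj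
  rw [hf.apply_zero] at hmem
  obtain ⟨l, hl, hd⟩ := hf.exists_dist_geodesic_le hu (x := f v w i) (by rwa [h0, hn])
  have h1 := hu 0 l (Nat.zero_le _) hl
  have h2 := hu l _ hl le_rfl
  rw [h0] at h1
  rw [hn] at h2
  have h3 := hf.connected.dist_triangle (u := f v w i) (v := u l) (w := f v w j)
  have h4 := hf.connected.dist_triangle (u := v) (v := u l) (w := f v w i)
  rw [SimpleGraph.dist_comm (u := u l) (v := f v w i)] at h4
  omega

/-- Distance from the origin serves as the parameter: stop when it first reaches `0, 1, 2, …`. By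
`dist_path_le` it decreases by at most `34` along the path, so it controls distances between the
stops and diameters in between. -/
theorem isUnparametrizedQuasiGeodesic (hf : IsSlimPathSystem Γ f len) (v w : V) :
    IsUnparametrizedQuasiGeodesic Γ 1 104 (f v w) (len v w) := by
  classical
  set m := len v w with hm
  set g : ℕ → ℕ := fun j => Γ.dist v (f v w j) with hg
  set N := g m with hN
  have g0 : g 0 = 0 := by simp [hg, hf.apply_zero]
  have gstep : ∀ i < m, g (i + 1) ≤ g i + 1 := fun i hi => by
    have := hf.dist_step_le hi v
    rwa [SimpleGraph.dist_comm, SimpleGraph.dist_comm (u := f v w i)] at this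
  have hfirst : ∀ c ≤ N, ∃ j ≤ m, g j = c ∧ ∀ i < j, g i < c := fun c hc =>
    exists_first_index (by omega) gstep hc
  choose! τ hτm hτg hτ using hfirst
  -- The path may reach distance `N` from `v` before its end, hence one extra stop `N + 1` at `m`;
  -- there the index exceeds the distance by one.
  set ρ : ℕ → ℕ := fun i => if i ≤ N then τ i else m with hρ
  have hρm : ∀ i, ρ i ≤ m := fun i => by
    simp only [hρ]; split_ifs with h
    · exact hτm i h
    · exact le_rfl
  have hρg : ∀ i ≤ N + 1, g (ρ i) ≤ i ∧ i ≤ g (ρ i) + 1 := fun i hi => by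
    simp only [hρ]; split_ifs with h
    · rw [hτg i h]; omega
    · omega
  have hρmono : ∀ i < N + 1, ρ i ≤ ρ (i + 1) := fun i hi => by
    by_cases h : i + 1 ≤ N
    · simp only [hρ, if_pos h, if_pos (show i ≤ N by omega)]
      by_contra hlt
      have h1 := hτ i (by omega) (τ (i + 1)) (by omega)
      rw [hτg (i + 1) h] at h1
      omega
    · have : ρ (i + 1) = m := by simp [hρ, h]
      rw [this]; exact hρm i
  have hρmono' : ∀ i j, i ≤ j → j ≤ N + 1 → ρ i ≤ ρ j := by
    intro i j hij
    induction j, hij using Nat.le_induction with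
    | base => intro _; exact le_rfl
    | succ j hij ih => intro hj; exact (ih (by omega)).trans (hρmono j (by omega))
  have tri := fun a b c => hf.connected.dist_triangle (u := a) (v := b) (w := c)
  have main : ∀ i j, i ≤ j → j ≤ N + 1 → Γ.dist (f v w (ρ i)) (f v w (ρ j)) ≤ j - i + 35 ∧
      j ≤ Γ.dist (f v w (ρ i)) (f v w (ρ j)) + i + 1 := by
    intro i j hij hj
    have h1 : _ ≤ g (ρ j) + 34 := hf.dist_path_le (hρmono' i j hij hj) (hρm j)
    have h2 : g (ρ j) ≤ g (ρ i) + _ := tri v (f v w (ρ i)) (f v w (ρ j))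
    have h3 := hρg i (by omega)
    have h4 := hρg j hj
    change Γ.dist (f v w (ρ i)) (f v w (ρ j)) + g (ρ i) ≤ g (ρ j) + 34 at h1
    constructor <;> omega
  have main' : ∀ i j, i ≤ j → j ≤ N + 1 →
      |(i : ℝ) - j| / 1 - 104 ≤ Γ.dist (f v w (ρ i)) (f v w (ρ j)) ∧
      (Γ.dist (f v w (ρ i)) (f v w (ρ j)) : ℝ) ≤ 1 * |(i : ℝ) - j| + 104 := by
    intro i j hij hj
    obtain ⟨h1, h2⟩ := main i j hij hj
    have hij' : (i : ℝ) ≤ j := by exact_mod_cast hij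
    have h1' : Γ.dist (f v w (ρ i)) (f v w (ρ j)) + i ≤ j + 35 := by omega
    have h1'' : (Γ.dist (f v w (ρ i)) (f v w (ρ j)) : ℝ) + i ≤ j + 35 := by exact_mod_cast h1'
    have h2'' : (j : ℝ) ≤ Γ.dist (f v w (ρ i)) (f v w (ρ j)) + i + 1 := by exact_mod_cast h2
    rw [abs_of_nonpos (by linarith)]
    constructor <;> linarith
  -- Three errors of `34` and a difference of at most `2` between the values of `g` at consecutive
  -- stops (by `hρg`) give `104`.
  have hclose : ∀ i ≤ N, ∀ s, ρ i ≤ s → s ≤ ρ (i + 1) → ∀ t, s ≤ t → t ≤ ρ (i + 1) →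
      Γ.dist (f v w s) (f v w t) ≤ 104 := by
    intro i hi s hs hs' t hst ht
    have h1 : Γ.dist (f v w s) (f v w t) + g s ≤ g t + 34 :=
      hf.dist_path_le hst (ht.trans (hρm _))
    have h2 : _ + g (ρ i) ≤ g s + 34 := hf.dist_path_le hs (hs'.trans (hρm _))
    have h3 : _ + g t ≤ g (ρ (i + 1)) + 34 := hf.dist_path_le ht (hρm _)
    have h4 := hρg i (by omega)
    have h5 := hρg (i + 1) (by omega)
    omega
  refine ⟨N + 1, ρ, ?_, by simp [hρ], hρmono, fun i hi j hj => ?_, fun i hi s hs t ht => ?_⟩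
  · simp only [hρ, if_pos (Nat.zero_le N)]
    by_contra h
    have := hτ 0 (Nat.zero_le _) 0 (by omega)
    omega
  · rcases le_total i j with h | h
    · exact main' i j h hj
    · rw [abs_sub_comm, SimpleGraph.dist_comm]
      exact main' j i h hi
  · have : Γ.dist (f v w s) (f v w t) ≤ 104 := by
      rcases le_total s t with h | h
      · exact hclose i (by omega) s hs.1 hs.2 t h ht.2
      · rw [SimpleGraph.dist_comm]
        exact hclose i (by omega) t ht.1 ht.2 s h hs.2
    exact_mod_cast this

/-- A path between two vertices at distance at most `4` is short. -/
theorem dist_right_le_of_dist_le_four (hf : IsSlimPathSystem Γ f len)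
    {v w x : V} (hvw : Γ.dist v w ≤ 4)
    (hx : x ∈ pathSet f len v w) : Γ.dist x v ≤ 9 ∧ Γ.dist x w ≤ 9 := by
  classical
  obtain ⟨p, hp⟩ := hf.connected.exists_walk_length_eq_dist v w
  obtain ⟨y, hy, hd⟩ := hf.exists_mem_support_dist_le 2 p (by omega) x hx
  have h1 := SimpleGraph.dist_le (p.takeUntil y hy)
  have h2 := SimpleGraph.dist_le (p.dropUntil y hy)
  have h3 := p.length_takeUntil_le_length hy
  have h4 := p.length_dropUntil_le_length hy
  have h5 := hf.connected.dist_triangle (u := x) (v := y) (w := v)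
  have h6 := hf.connected.dist_triangle (u := x) (v := y) (w := w)
  rw [SimpleGraph.dist_comm (u := y) (v := v)] at h5
  constructor <;> omega

/-- Geodesic triangles whose corners match up to distance `4` are `57`-slim. -/
theorem exists_dist_le_fifty_seven (hf : IsSlimPathSystem Γ f len) {u₁ u₂ u₃ : ℕ → V} {n₁ n₂ n₃ : ℕ}
    (h₁ : IsVertexGeodesic Γ u₁ n₁) (h₂ : IsVertexGeodesic Γ u₂ n₂)
    (h₃ : IsVertexGeodesic Γ u₃ n₃) (hp : Γ.dist (u₁ 0) (u₃ 0) ≤ 4)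
    (hq : Γ.dist (u₂ 0) (u₁ n₁) ≤ 4) (hr : Γ.dist (u₃ n₃) (u₂ n₂) ≤ 4) {i : ℕ} (hi : i ≤ n₁) :
    (∃ j ≤ n₂, Γ.dist (u₁ i) (u₂ j) ≤ 57) ∨ ∃ j ≤ n₃, Γ.dist (u₁ i) (u₃ j) ≤ 57 := by
  have tri := fun a b c => hf.connected.dist_triangle (u := a) (v := b) (w := c)
  -- From the geodesic to its path costs `34`, each triangle `2`, and the return to a geodesic `17`.
  -- The mismatched corners require at most three triangles: `34 + 2 + 2 + 2 + 17 = 57`.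
  obtain ⟨x, hx, hix⟩ := hf.exists_dist_path_le h₁ hi
  obtain ⟨y, hy, hxy⟩ := hf.slim (u₁ 0) (u₃ n₃) (u₁ n₁) x hx
  have t1 := tri (u₁ i) x y
  rcases hy with hy | hy
  · right
    obtain ⟨z, hz, hyz⟩ := hf.slim (u₁ 0) (u₃ 0) (u₃ n₃) y hy
    have t2 := tri (u₁ i) y z
    rcases hz with hz | hz
    · have t3 := tri (u₁ i) z (u₃ 0)
      have := (hf.dist_right_le_of_dist_le_four hp hz).2
      exact ⟨0, Nat.zero_le _, by omega⟩
    · obtain ⟨j, hj, hd⟩ := hf.exists_dist_geodesic_le h₃ hz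
      have t3 := tri (u₁ i) z (u₃ j)
      exact ⟨j, hj, by omega⟩
  · left
    obtain ⟨z, hz, hyz⟩ := hf.slim (u₃ n₃) (u₂ 0) (u₁ n₁) y hy
    have t2 := tri (u₁ i) y z
    rcases hz with hz | hz
    · obtain ⟨s, hs, hzs⟩ := hf.slim (u₃ n₃) (u₂ n₂) (u₂ 0) z hz
      have t3 := tri (u₁ i) z s
      rcases hs with hs | hs
      · have t4 := tri (u₁ i) s (u₂ n₂)
        have := (hf.dist_right_le_of_dist_le_four hr hs).2
        exact ⟨n₂, le_rfl, by omega⟩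
      · obtain ⟨j, hj, hd⟩ := hf.exists_dist_geodesic_le h₂.reverse (x := s) (by simpa using hs)
        have t4 := tri (u₁ i) s (u₂ (n₂ - j))
        exact ⟨n₂ - j, by omega, by omega⟩
    · have t3 := tri (u₁ i) z (u₂ 0)
      have := (hf.dist_right_le_of_dist_le_four hq hz).1
      exact ⟨0, Nat.zero_le _, by omega⟩

end IsSlimPathSystem
end PathSystems
-- From the geometric realization to vertices
section Realization

variable {V : Type*} {Γ : SimpleGraph V}

/-- The distance from a point of the realization to a vertex. -/
noncomputable def distVertex (x : Point Γ) (u : V) : ℝ :=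
  min (x.t + Γ.dist x.a u) (1 - x.t + Γ.dist x.b u)

theorem distVertex_nonneg (x : Point Γ) (u : V) : 0 ≤ distVertex x u :=
  le_min (add_nonneg x.t_nonneg (Nat.cast_nonneg _))
    (add_nonneg (sub_nonneg.2 x.t_le_one) (Nat.cast_nonneg _))

theorem distVertex_vertex (v u : V) : distVertex (vertex Γ v) u = Γ.dist v u := by
  simp [distVertex, vertex]

theorem distThroughEnds_eq (p q : Point Γ) :
    distThroughEnds p q = min (p.t + distVertex q p.a) (1 - p.t + distVertex q p.b) := by
  simp only [distThroughEnds, distVertex, ← min_add_add_left, SimpleGraph.dist_comm (u := q.a),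
    SimpleGraph.dist_comm (u := q.b)]
  congr 2 <;> ring

theorem dist_ends_le (x : Point Γ) : Γ.dist x.a x.b ≤ 1 := by
  rcases x.adj_or_vertex with h | h
  · exact (SimpleGraph.dist_eq_one_iff_adj.2 h).le
  · simp [h.1]

theorem cast_dist_triangle (hc : Γ.Connected) (u v w : V) :
    (Γ.dist u w : ℝ) ≤ Γ.dist u v + Γ.dist v w := by
  exact_mod_cast hc.dist_triangle

theorem pointDist_le_distThroughEnds (p q : Point Γ) : pointDist p q ≤ distThroughEnds p q := by
  unfold pointDist
  split_ifs
  · exact min_le_left _ _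
  · exact min_le_left _ _
  · exact le_rfl

theorem distVertex_le_add_dist (hc : Γ.Connected) (x : Point Γ) (u v : V) :
    distVertex x v ≤ distVertex x u + Γ.dist u v := by
  have h1 := cast_dist_triangle hc x.a u v
  have h2 := cast_dist_triangle hc x.b u v
  unfold distVertex
  rcases min_choice (x.t + Γ.dist x.a u : ℝ) (1 - x.t + Γ.dist x.b u) with h | h
  · rw [h]; exact (min_le_left _ _).trans (by linarith)
  · rw [h]; exact (min_le_right _ _).trans (by linarith)

theorem dist_le_distVertex_add (hc : Γ.Connected) (x : Point Γ) (u v : V) :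
    Γ.dist u v ≤ distVertex x u + distVertex x v := by
  have h0 : (Γ.dist x.a x.b : ℝ) ≤ 1 := by exact_mod_cast dist_ends_le x
  have h1 := cast_dist_triangle hc u x.a v
  have h2 := cast_dist_triangle hc u x.b v
  have h3 := cast_dist_triangle hc x.a x.b v
  have h4 := cast_dist_triangle hc x.b x.a v
  rw [SimpleGraph.dist_comm (u := u) (v := x.a)] at h1
  rw [SimpleGraph.dist_comm (u := u) (v := x.b)] at h2
  rw [SimpleGraph.dist_comm (u := x.b) (v := x.a)] at h4
  have h5 := x.t_nonneg
  have h6 := x.t_le_one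
  unfold distVertex
  rcases min_choice (x.t + Γ.dist x.a u : ℝ) (1 - x.t + Γ.dist x.b u) with h | h <;>
  rcases min_choice (x.t + Γ.dist x.a v : ℝ) (1 - x.t + Γ.dist x.b v) with h' | h' <;>
  rw [h, h'] <;> linarith

theorem pointDist_le (hc : Γ.Connected) (x y : Point Γ) (u v : V) :
    pointDist x y ≤ distVertex x u + Γ.dist u v + distVertex y v := by
  refine (pointDist_le_distThroughEnds x y).trans ?_
  rw [distThroughEnds_eq]
  have ha := distVertex_le_add_dist hc y v x.a
  have hb := distVertex_le_add_dist hc y v x.b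
  have h1 := cast_dist_triangle hc x.a u v
  have h2 := cast_dist_triangle hc x.b u v
  rw [SimpleGraph.dist_comm (u := v)] at ha hb
  rcases min_choice (x.t + Γ.dist x.a u : ℝ) (1 - x.t + Γ.dist x.b u) with h | h
  · refine (min_le_left _ _).trans ?_
    rw [distVertex.eq_1 x, h]
    linarith
  · refine (min_le_right _ _).trans ?_
    rw [distVertex.eq_1 x, h]
    linarith

/-- The point `x` lies on the edge from `a` to `b`, at distance `s` from `a`. -/
def IsOnEdge (x : Point Γ) (a b : V) (s : ℝ) : Prop :=
  (x.a = a ∧ x.b = b ∧ x.t = s) ∨ (x.a = b ∧ x.b = a ∧ x.t = 1 - s)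

theorem IsOnEdge.symm {x : Point Γ} {a b : V} {s : ℝ} (h : IsOnEdge x a b s) :
    IsOnEdge x b a (1 - s) := by
  rcases h with h | h
  · exact .inr ⟨h.1, h.2.1, by rw [h.2.2]; ring⟩
  · exact .inl h

theorem IsOnEdge.distVertex_eq {x : Point Γ} {a b : V} {s : ℝ} (h : IsOnEdge x a b s) (u : V) :
    distVertex x u = min (s + Γ.dist a u) (1 - s + Γ.dist b u) := by
  rcases h with ⟨rfl, rfl, rfl⟩ | ⟨rfl, rfl, h⟩
  · rfl
  · rw [distVertex, h, min_comm]
    congr 2; ring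

theorem IsOnEdge.mem_Icc {x : Point Γ} {a b : V} {s : ℝ} (h : IsOnEdge x a b s) :
    0 ≤ s ∧ s ≤ 1 := by
  have h1 := x.t_nonneg
  have h2 := x.t_le_one
  rcases h with ⟨-, -, rfl⟩ | ⟨-, -, h⟩
  · exact ⟨h1, h2⟩
  · constructor <;> linarith

theorem IsOnEdge.distVertex_left {x : Point Γ} {a b : V} {s : ℝ} (h : IsOnEdge x a b s)
    (hab : Γ.Adj a b) : distVertex x a = s := by
  have := h.mem_Icc
  rw [h.distVertex_eq, SimpleGraph.dist_comm (u := b), SimpleGraph.dist_eq_one_iff_adj.2 hab,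
    SimpleGraph.dist_self, min_eq_left] <;> push_cast <;> linarith

theorem IsOnEdge.distVertex_right {x : Point Γ} {a b : V} {s : ℝ} (h : IsOnEdge x a b s)
    (hab : Γ.Adj a b) : distVertex x b = 1 - s :=
  h.symm.distVertex_left hab.symm

/-- The minima in `pointDist` are resolved into three routes: inside the edge of `x`, or out through
one of its two ends. -/
theorem pointDist_cases (x y : Point Γ) :
    (∃ s, IsOnEdge y x.a x.b s ∧ pointDist x y = |x.t - s|) ∨
      pointDist x y = x.t + distVertex y x.a ∨ pointDist x y = 1 - x.t + distVertex y x.b := by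
  have hE := min_choice (x.t + distVertex y x.a) (1 - x.t + distVertex y x.b)
  rw [← distThroughEnds_eq] at hE
  unfold pointDist
  split_ifs with h h'
  · rcases min_choice (distThroughEnds x y) |x.t - y.t| with h1 | h1
    · rw [h1]; exact .inr hE
    · rw [h1]; exact .inl ⟨y.t, .inl ⟨h.1.symm, h.2.symm, rfl⟩, rfl⟩
  · rcases min_choice (distThroughEnds x y) |x.t - (1 - y.t)| with h1 | h1
    · rw [h1]; exact .inr hE
    · rw [h1]; exact .inl ⟨1 - y.t, .inr ⟨h'.2.symm, h'.1.symm, by ring⟩, rfl⟩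
  · exact .inr hE

theorem IsOnEdge.pointDist_cases {x : Point Γ} {a b : V} {s : ℝ} (h : IsOnEdge x a b s)
    (y : Point Γ) : (∃ t, IsOnEdge y a b t ∧ pointDist x y = |s - t|) ∨
      pointDist x y = s + distVertex y a ∨ pointDist x y = 1 - s + distVertex y b := by
  have key := MetricGraph.pointDist_cases x y
  rcases h with ⟨rfl, rfl, rfl⟩ | ⟨rfl, rfl, h⟩
  · exact key
  · rw [h] at key
    rcases key with ⟨t, ht, hd⟩ | hd | hd
    · exact .inl ⟨1 - t, ht.symm, by rw [hd, abs_sub_comm]; congr 1; ring⟩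
    · exact .inr (.inr hd)
    · exact .inr (.inl (by rw [hd]; ring))

theorem IsOnEdge.pointDist_le {x y : Point Γ} {a b : V} {s t : ℝ} (hx : IsOnEdge x a b s)
    (hy : IsOnEdge y a b t) : pointDist x y ≤ |s - t| := by
  unfold pointDist
  rcases hx with ⟨h1, h2, h3⟩ | ⟨h1, h2, h3⟩ <;> rcases hy with ⟨h4, h5, h6⟩ | ⟨h4, h5, h6⟩
  · rw [if_pos ⟨h1.trans h4.symm, h2.trans h5.symm⟩, h3, h6]; exact min_le_right _ _
  · split_ifs with h h'
    · refine (min_le_right _ _).trans ?_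
      have hx := x.adj_or_vertex
      have hy := y.adj_or_vertex
      have hab : a = b := by rw [← h1, h.1, h4]
      rw [h1, h2] at hx
      rw [h4, h5] at hy
      rcases hx with hx | hx
      · exact absurd hab hx.ne
      · rcases hy with hy | hy
        · exact absurd hab.symm hy.ne
        · simp [hx.2, hy.2]
    · refine (min_le_right _ _).trans ?_
      rw [h3, h6]; simp
    · exact absurd ⟨h1.trans h5.symm, h2.trans h4.symm⟩ h'
  · split_ifs with h h'
    · refine (min_le_right _ _).trans ?_
      have hx := x.adj_or_vertex
      have hy := y.adj_or_vertex
      have hab : a = b := by rw [← h2, h.2, h5]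
      rw [h1, h2] at hx
      rw [h4, h5] at hy
      rcases hx with hx | hx
      · exact absurd hab.symm hx.ne
      · rcases hy with hy | hy
        · exact absurd hab hy.ne
        · simp [hx.2, hy.2]
    · refine (min_le_right _ _).trans ?_
      rw [h3, h6, abs_sub_comm]; apply le_of_eq; congr 1; ring
    · exact absurd ⟨h1.trans h5.symm, h2.trans h4.symm⟩ h'
  · rw [if_pos ⟨h1.trans h4.symm, h2.trans h5.symm⟩, h3, h6, abs_sub_comm]
    refine (min_le_right _ _).trans (le_of_eq ?_)
    congr 1; ring

/-- Together with `pointDist_le` and `dist_le_distVertex_add`, this replaces the triangle inequality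
for `pointDist`: all comparisons go through vertices. -/
theorem distVertex_le_add_pointDist (hc : Γ.Connected) (x y : Point Γ) (u : V) :
    distVertex y u ≤ distVertex x u + pointDist x y := by
  have h0 : (Γ.dist x.a x.b : ℝ) ≤ 1 := by exact_mod_cast dist_ends_le x
  have h3 := cast_dist_triangle hc x.a x.b u
  have h4 := cast_dist_triangle hc x.b x.a u
  rw [SimpleGraph.dist_comm (u := x.b) (v := x.a)] at h4
  have h5 := x.t_nonneg
  have h6 := x.t_le_one
  rcases pointDist_cases x y with ⟨s, hs, h⟩ | h | h
  · rw [hs.distVertex_eq, h, distVertex]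
    have h7 := le_abs_self (x.t - s)
    have h8 := neg_abs_le (x.t - s)
    rcases min_choice (x.t + Γ.dist x.a u : ℝ) (1 - x.t + Γ.dist x.b u) with h' | h'
    · rw [h']; exact (min_le_left _ _).trans (by linarith)
    · rw [h']; exact (min_le_right _ _).trans (by linarith)
  · have h7 := distVertex_le_add_dist hc y x.a u
    rcases min_choice (x.t + Γ.dist x.a u : ℝ) (1 - x.t + Γ.dist x.b u) with h' | h' <;>
    rw [h, distVertex.eq_1 x, h'] <;> linarith
  · have h7 := distVertex_le_add_dist hc y x.b u
    rcases min_choice (x.t + Γ.dist x.a u : ℝ) (1 - x.t + Γ.dist x.b u) with h' | h' <;>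
    rw [h, distVertex.eq_1 x, h'] <;> linarith

/-- An integral distance to a vertex makes the edge coordinate integral, so the point is an end of
its edge. -/
theorem exists_distVertex_eq_zero_of_eq_natCast {x : Point Γ} {u : V} {n : ℕ}
    (h : distVertex x u = n) : ∃ v, distVertex x v = 0 := by
  have h5 := x.t_nonneg
  have h6 := x.t_le_one
  have hint : ∃ z : ℤ, x.t = z := by
    unfold distVertex at h
    rcases min_choice (x.t + Γ.dist x.a u : ℝ) (1 - x.t + Γ.dist x.b u) with h' | h' <;>
    rw [h'] at h
    · exact ⟨n - Γ.dist x.a u, by push_cast; linarith⟩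
    · exact ⟨1 + Γ.dist x.b u - n, by push_cast; linarith⟩
  obtain ⟨z, hz⟩ := hint
  rw [hz] at h5 h6
  have h7 : 0 ≤ z := by exact_mod_cast h5
  have h8 : z ≤ 1 := by exact_mod_cast h6
  obtain rfl | rfl : z = 0 ∨ z = 1 := by omega
  · exact ⟨x.a, le_antisymm ((min_le_left _ _).trans (by simp [hz])) (distVertex_nonneg _ _)⟩
  · exact ⟨x.b, le_antisymm ((min_le_right _ _).trans (by simp [hz])) (distVertex_nonneg _ _)⟩

/-- A geodesic of length at least `1` runs through a vertex during its first unit of time. -/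
theorem exists_vertex_on_geodesic {γ : ℝ → Point Γ} {L : ℝ} (hL : 1 ≤ L)
    (hγ : ∀ s ∈ Set.Icc 0 L, ∀ t ∈ Set.Icc 0 L, pointDist (γ s) (γ t) = |s - t|) :
    ∃ s, 0 ≤ s ∧ s ≤ 1 ∧ ∃ u, distVertex (γ s) u = 0 := by
  -- Let `a` be the nearer end, at distance `t`. No continuity is used: the distances between the
  -- points at times `0`, `t` and `1 - t` suffice. Either `γ t` is a vertex, or it moved towards `b`
  -- to position `2 * t`, and then `γ (1 - t)` is a vertex.
  have main : ∀ (a b : V) (t : ℝ), Γ.Adj a b → IsOnEdge (γ 0) a b t → t ≤ 1 / 2 →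
      ∃ s, 0 ≤ s ∧ s ≤ 1 ∧ ∃ u, distVertex (γ s) u = 0 := by
    intro a b t hab h0 ht
    have ht0 := h0.mem_Icc.1
    rcases ht0.eq_or_lt with rfl | htpos
    · exact ⟨0, le_rfl, zero_le_one, a, h0.distVertex_left hab⟩
    have d1 : pointDist (γ 0) (γ t) = t := by
      rw [hγ 0 ⟨le_rfl, by linarith⟩ t ⟨ht0, by linarith⟩, zero_sub, abs_neg, abs_of_nonneg ht0]
    have d2 : pointDist (γ 0) (γ (1 - t)) = 1 - t := by
      rw [hγ 0 ⟨le_rfl, by linarith⟩ (1 - t) ⟨by linarith, by linarith⟩, zero_sub, abs_neg,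
        abs_of_nonneg (by linarith)]
    have d3 : pointDist (γ t) (γ (1 - t)) = 1 - 2 * t := by
      rw [hγ t ⟨by linarith, by linarith⟩ (1 - t) ⟨by linarith, by linarith⟩, abs_sub_comm,
        abs_of_nonneg (by linarith)]
      ring
    have hy : ∀ u, distVertex (γ t) u = 0 → ∃ s, 0 ≤ s ∧ s ≤ 1 ∧ ∃ u, distVertex (γ s) u = 0 :=
      fun u hu => ⟨t, ht0, by linarith, u, hu⟩
    have hz : ∀ u, distVertex (γ (1 - t)) u = 0 →
        ∃ s, 0 ≤ s ∧ s ≤ 1 ∧ ∃ u, distVertex (γ s) u = 0 :=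
      fun u hu => ⟨1 - t, by linarith, by linarith, u, hu⟩
    have ny := distVertex_nonneg (γ t)
    have nz := distVertex_nonneg (γ (1 - t))
    rcases h0.pointDist_cases (γ t) with ⟨s, hs, h⟩ | h | h <;> rw [d1] at h
    · rcases abs_cases (t - s) with ⟨h', -⟩ | ⟨h', -⟩
      · exact hy a (by rw [hs.distVertex_left hab]; linarith)
      have hs2 : s = 2 * t := by linarith
      subst hs2
      rcases h0.pointDist_cases (γ (1 - t)) with ⟨r, hr, h2⟩ | h2 | h2 <;> rw [d2] at h2
      · have := hr.mem_Icc
        rcases abs_cases (t - r) with ⟨h3, -⟩ | ⟨h3, -⟩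
        · exact hz a (by rw [hr.distVertex_left hab]; linarith)
        · exact hz b (by rw [hr.distVertex_right hab]; linarith)
      · rcases hs.pointDist_cases (γ (1 - t)) with ⟨r, hr, h3⟩ | h3 | h3 <;> rw [d3] at h3
        · have h4 := hr.distVertex_left hab
          have h5 := h0.pointDist_le hr
          rw [d2] at h5
          rcases abs_cases (t - r) with ⟨h6, -⟩ | ⟨h6, -⟩
          · exact hz a (by linarith [nz a])
          · linarith
        · linarith
        · exact hz b (by linarith)
      · exact hz b (by linarith)
    · exact hy a (by linarith)
    · exact hy b (by linarith [ny b])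
  rcases (γ 0).adj_or_vertex with h | h
  · rcases le_total (γ 0).t (1 / 2) with ht | ht
    · exact main _ _ _ h (.inl ⟨rfl, rfl, rfl⟩) ht
    · exact main _ _ (1 - (γ 0).t) h.symm (.inr ⟨rfl, rfl, by ring⟩) (by linarith)
  · exact ⟨0, le_rfl, zero_le_one, (γ 0).a,
      le_antisymm ((min_le_left _ _).trans (by simp [h.2])) (distVertex_nonneg _ _)⟩

/-- A geodesic which runs through a vertex runs through the vertices of a geodesic edge path. -/
theorem exists_isVertexGeodesic_of_geodesic (hc : Γ.Connected) {γ : ℝ → Point Γ} {L : ℝ}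
    (hγ : ∀ s ∈ Set.Icc 0 L, ∀ t ∈ Set.Icc 0 L, pointDist (γ s) (γ t) = |s - t|)
    {s₀ : ℝ} (h0 : 0 ≤ s₀) {u₀ : V} (hu₀ : distVertex (γ s₀) u₀ = 0) {n : ℕ} (hn : s₀ + n ≤ L) :
    ∃ u, IsVertexGeodesic Γ u n ∧ ∀ i ≤ n, distVertex (γ (s₀ + i)) (u i) = 0 := by
  have hI : ∀ i ≤ n, s₀ + (i : ℝ) ∈ Set.Icc 0 L := fun i hi => by
    have : (i : ℝ) ≤ n := by exact_mod_cast hi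
    constructor <;> [positivity; linarith]
  have hI0 : s₀ ∈ Set.Icc 0 L := by simpa using hI 0 (Nat.zero_le _)
  have hex : ∀ i ≤ n, ∃ v, distVertex (γ (s₀ + i)) v = 0 := fun i hi => by
    refine exists_distVertex_eq_zero_of_eq_natCast (u := u₀) (n := i) (le_antisymm ?_ ?_)
    · have := distVertex_le_add_pointDist hc (γ s₀) (γ (s₀ + i)) u₀
      rwa [hu₀, hγ _ hI0 _ (hI i hi), sub_add_cancel_left, abs_neg, Nat.abs_cast, zero_add] at this
    · have := pointDist_le hc (γ s₀) (γ (s₀ + i)) u₀ u₀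
      rwa [hu₀, hγ _ hI0 _ (hI i hi), sub_add_cancel_left, abs_neg, Nat.abs_cast,
        SimpleGraph.dist_self, Nat.cast_zero, zero_add, zero_add] at this
  have : Nonempty V := ⟨u₀⟩
  choose! u hu using hex
  refine ⟨u, fun i j hij hj => ?_, hu⟩
  have hi := hij.trans hj
  have hd := hγ _ (hI i hi) _ (hI j hj)
  have hij' : (i : ℝ) ≤ j := by exact_mod_cast hij
  rw [abs_sub_comm, abs_of_nonneg (by linarith)] at hd
  have h1 := pointDist_le hc (γ (s₀ + i)) (γ (s₀ + j)) (u i) (u j)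
  have h2 := distVertex_le_add_pointDist hc (γ (s₀ + i)) (γ (s₀ + j)) (u i)
  have h3 := dist_le_distVertex_add hc (γ (s₀ + j)) (u i) (u j)
  rw [hu i hi, hu j hj, hd] at h1
  rw [hu i hi, hd] at h2
  rw [hu j hj] at h3
  have h4 : (j : ℝ) ≤ Γ.dist (u i) (u j) + i := by linarith
  have h5 : (Γ.dist (u i) (u j) : ℝ) + i ≤ j := by linarith
  norm_cast at h4 h5
  omega

theorem exists_floor_dist_lt {s₀ s : ℝ} {n : ℕ} (h0 : s₀ ≤ s) (hs : s < s₀ + n + 1) :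
    ∃ i ≤ n, |s₀ + (i : ℝ) - s| ≤ 1 := by
  have h1 := Nat.floor_le (sub_nonneg.2 h0)
  have h2 := Nat.lt_floor_add_one (s - s₀)
  refine ⟨⌊s - s₀⌋₊, ?_, by rw [abs_le]; constructor <;> linarith⟩
  have : (⌊s - s₀⌋₊ : ℝ) < n + 1 := by linarith
  norm_cast at this
  omega

/-- Every geodesic of the realization fellow-travels a geodesic edge path. -/
theorem IsGeodesicSegment.exists_isVertexGeodesic (hc : Γ.Connected) {S : Set (Point Γ)}
    {p q : Point Γ} (hS : IsGeodesicSegment S p q) :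
    ∃ (u : ℕ → V) (n : ℕ), IsVertexGeodesic Γ u n ∧ distVertex p (u 0) ≤ 3 / 2 ∧
      distVertex q (u n) ≤ 3 / 2 ∧ (∀ x ∈ S, ∃ i ≤ n, distVertex x (u i) ≤ 3 / 2) ∧
      ∀ i ≤ n, ∃ y ∈ S, distVertex y (u i) ≤ 1 / 2 := by
  obtain ⟨L, γ, hL, rfl, rfl, hγ, rfl⟩ := hS
  have hmem : ∀ s ∈ Set.Icc 0 L, ∀ t ∈ Set.Icc 0 L, ∀ u,
      distVertex (γ t) u ≤ distVertex (γ s) u + |s - t| := fun s hs t ht u => by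
    rw [← hγ s hs t ht]; exact distVertex_le_add_pointDist hc _ _ _
  have hL0 : (0 : ℝ) ∈ Set.Icc 0 L := ⟨le_rfl, hL⟩
  have hLL : L ∈ Set.Icc 0 L := ⟨hL, le_rfl⟩
  -- A geodesic shorter than `1` may miss all vertices; the constant edge path at the end nearest to
  -- its origin replaces it.
  rcases lt_or_ge L 1 with h1 | h1
  · have hu : ∃ u, distVertex (γ 0) u ≤ 1 / 2 := by
      rcases le_total (γ 0).t (1 / 2) with h | h
      · exact ⟨(γ 0).a, (min_le_left _ _).trans (by simpa using h)⟩
      · exact ⟨(γ 0).b, (min_le_right _ _).trans (by simp; linarith)⟩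
    obtain ⟨u, hu⟩ := hu
    have hall : ∀ s ∈ Set.Icc 0 L, distVertex (γ s) u ≤ 3 / 2 := fun s hs => by
      have := hmem 0 hL0 s hs u
      rw [zero_sub, abs_neg, abs_of_nonneg hs.1] at this
      linarith [hs.2]
    refine ⟨fun _ => u, 0, fun i j hij hj => ?_, hall 0 hL0, hall L hLL, ?_,
      fun i _ => ⟨γ 0, ⟨0, hL0, rfl⟩, hu⟩⟩
    · simp; omega
    · rintro _ ⟨s, hs, rfl⟩
      exact ⟨0, le_rfl, hall s hs⟩
  · obtain ⟨s₀, hs0, hs1, u₀, hu₀⟩ := exists_vertex_on_geodesic h1 hγ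
    set n := ⌊L - s₀⌋₊ with hn
    have hn1 := Nat.floor_le (show 0 ≤ L - s₀ by linarith)
    have hn2 := Nat.lt_floor_add_one (L - s₀)
    obtain ⟨u, hu, hd⟩ := exists_isVertexGeodesic_of_geodesic hc hγ hs0 hu₀ (n := n)
      (by linarith)
    have hI : ∀ i ≤ n, s₀ + (i : ℝ) ∈ Set.Icc 0 L := fun i hi => by
      have : (i : ℝ) ≤ n := by exact_mod_cast hi
      constructor <;> [positivity; linarith]
    have hnear : ∀ s ∈ Set.Icc 0 L, ∀ i ≤ n, |s₀ + (i : ℝ) - s| ≤ 1 →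
        distVertex (γ s) (u i) ≤ 3 / 2 := fun s hs i hi h => by
      have := hmem _ (hI i hi) s hs (u i)
      rw [hd i hi] at this
      linarith
    refine ⟨u, n, hu, hnear 0 hL0 0 (Nat.zero_le _) ?_, hnear L hLL n le_rfl ?_, ?_, ?_⟩
    · rw [abs_le]; constructor <;> push_cast <;> linarith
    · rw [abs_le]; constructor <;> linarith
    · rintro _ ⟨s, hs, rfl⟩
      rcases le_total s₀ s with h | h
      · obtain ⟨i, hi, hlt⟩ := exists_floor_dist_lt (n := n) h (by linarith [hs.2])
        exact ⟨i, hi, hnear s hs i hi hlt⟩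
      · refine ⟨0, Nat.zero_le _, hnear s hs 0 (Nat.zero_le _) ?_⟩
        rw [abs_le]; constructor <;> push_cast <;> linarith [hs.1]
    · intro i hi
      exact ⟨_, ⟨_, hI i hi, rfl⟩, by rw [hd i hi]; norm_num⟩

/-- A geodesic between vertices runs through the vertices of a geodesic edge path. -/
theorem IsGeodesicSegment.exists_isVertexGeodesic_vertex (hc : Γ.Connected) {S : Set (Point Γ)}
    {v w : V} (hS : IsGeodesicSegment S (vertex Γ v) (vertex Γ w)) :
    ∃ (u : ℕ → V) (n : ℕ), IsVertexGeodesic Γ u n ∧ u 0 = v ∧ u n = w ∧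
      (∀ x ∈ S, ∃ i ≤ n, distVertex x (u i) ≤ 1) ∧ ∀ i ≤ n, ∃ y ∈ S, distVertex y (u i) = 0 := by
  obtain ⟨L, γ, hL, h0, h1, hγ, rfl⟩ := hS
  have hLd : L = Γ.dist v w := by
    have h2 := hγ 0 ⟨le_rfl, hL⟩ L ⟨hL, le_rfl⟩
    rw [zero_sub, abs_neg, abs_of_nonneg hL, h0, h1] at h2
    have h3 := pointDist_le hc (vertex Γ v) (vertex Γ w) v w
    have h4 := distVertex_le_add_pointDist hc (vertex Γ v) (vertex Γ w) v
    rw [distVertex_vertex, distVertex_vertex, SimpleGraph.dist_self, SimpleGraph.dist_self] at h3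
    rw [distVertex_vertex, distVertex_vertex, SimpleGraph.dist_self,
      SimpleGraph.dist_comm] at h4
    rw [h2] at h3 h4
    push_cast at h3 h4
    linarith
  have hv : distVertex (γ 0) v = 0 := by rw [h0, distVertex_vertex]; simp
  obtain ⟨u, hu, hd⟩ := exists_isVertexGeodesic_of_geodesic hc hγ le_rfl hv (n := Γ.dist v w)
    (by rw [hLd, zero_add])
  simp only [zero_add] at hd
  have hI : ∀ i ≤ Γ.dist v w, (i : ℝ) ∈ Set.Icc 0 L := fun i hi => by
    rw [hLd]; exact ⟨by positivity, by exact_mod_cast hi⟩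
  refine ⟨u, Γ.dist v w, hu, ?_, ?_, ?_, fun i hi => ⟨_, ⟨_, hI i hi, rfl⟩, hd i hi⟩⟩
  · have := hd 0 (Nat.zero_le _)
    rw [Nat.cast_zero, h0, distVertex_vertex, Nat.cast_eq_zero, hc.dist_eq_zero_iff] at this
    exact this.symm
  · have := hd _ le_rfl
    rw [← hLd, h1, distVertex_vertex, Nat.cast_eq_zero, hc.dist_eq_zero_iff] at this
    exact this.symm
  · rintro _ ⟨s, hs, rfl⟩
    obtain ⟨i, hi, hlt⟩ := exists_floor_dist_lt (n := Γ.dist v w) hs.1 (by linarith [hs.2])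
    rw [zero_add] at hlt
    refine ⟨i, hi, ?_⟩
    have := distVertex_le_add_pointDist hc (γ i) (γ s) (u i)
    rw [hd i hi, hγ _ (hI i hi) _ hs] at this
    linarith

variable {f : V → V → ℕ → V} {len : V → V → ℕ}

/-- Passing to edge paths and back costs `3 / 2` and `1 / 2` on top of `57`, which is within `60`.
Approximating edge paths at a common corner start or end at distance at most `3`, within the allowed
`4`. -/
theorem IsSlimPathSystem.isHyperbolic (hf : IsSlimPathSystem Γ f len) : IsHyperbolic Γ 60 := by
  have hc := hf.connected
  refine ⟨hc, fun p q r S₁ S₂ S₃ h₁ h₂ h₃ x hx => ?_⟩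
  obtain ⟨u₁, n₁, hu₁, hp₁, hq₁, hS₁, -⟩ := h₁.exists_isVertexGeodesic hc
  obtain ⟨u₂, n₂, hu₂, hq₂, hr₂, -, hS₂⟩ := h₂.exists_isVertexGeodesic hc
  obtain ⟨u₃, n₃, hu₃, hp₃, hr₃, -, hS₃⟩ := h₃.exists_isVertexGeodesic hc
  have hcorner : ∀ (y : Point Γ) (v w : V), distVertex y v ≤ 3 / 2 → distVertex y w ≤ 3 / 2 →
      Γ.dist v w ≤ 4 := fun y v w hv hw => by
    have := dist_le_distVertex_add hc y v w
    have h : (Γ.dist v w : ℝ) ≤ (4 : ℕ) := by push_cast; linarith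
    exact_mod_cast h
  obtain ⟨i, hi, hxi⟩ := hS₁ x hx
  have hend : ∀ y v, Γ.dist (u₁ i) v ≤ 57 → distVertex y v ≤ 1 / 2 → pointDist x y ≤ 60 :=
    fun y v hv hy => by
      have := pointDist_le hc x y (u₁ i) v
      have h : (Γ.dist (u₁ i) v : ℝ) ≤ (57 : ℕ) := by exact_mod_cast hv
      push_cast at h
      linarith
  rcases hf.exists_dist_le_fifty_seven hu₁ hu₂ hu₃ (hcorner p _ _ hp₁ hp₃)
    (hcorner q _ _ hq₂ hq₁) (hcorner r _ _ hr₃ hr₂) hi with ⟨j, hj, hd⟩ | ⟨j, hj, hd⟩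
  · obtain ⟨y, hy, hyd⟩ := hS₂ j hj
    exact ⟨y, .inl hy, hend y _ hd hyd⟩
  · obtain ⟨y, hy, hyd⟩ := hS₃ j hj
    exact ⟨y, .inr hy, hend y _ hd hyd⟩

theorem IsSlimPathSystem.isInNeighborhood_geodesic (hf : IsSlimPathSystem Γ f len) {v w : V}
    {S : Set (Point Γ)} (hS : IsGeodesicSegment S (vertex Γ v) (vertex Γ w)) :
    IsInNeighborhood 39 (pathPoints Γ (f v w) (len v w)) S ∧
      IsInNeighborhood 39 S (pathPoints Γ (f v w) (len v w)) := by
  have hc := hf.connected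
  obtain ⟨u, n, hu, rfl, rfl, hSu, huS⟩ := hS.exists_isVertexGeodesic_vertex hc
  have hpath : ∀ x ∈ pathPoints Γ (f (u 0) (u n)) (len (u 0) (u n)),
      ∃ i ≤ len (u 0) (u n), distVertex x (f (u 0) (u n) i) ≤ 1 := by
    rintro x (⟨i, hi, rfl⟩ | ⟨i, hi, ha, -⟩)
    · exact ⟨i, hi, by rw [distVertex_vertex]; simp⟩
    · exact ⟨i, hi.le, (min_le_left _ _).trans (by rw [ha]; simpa using x.t_le_one)⟩
  refine ⟨fun x hx => ?_, fun x hx => ?_⟩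
  · obtain ⟨i, hi, hxi⟩ := hpath x hx
    obtain ⟨j, hj, hd⟩ := hf.exists_dist_geodesic_le hu ⟨i, hi, rfl⟩
    obtain ⟨y, hy, hyd⟩ := huS j hj
    have := pointDist_le hc x y (f (u 0) (u n) i) (u j)
    have h : (Γ.dist (f (u 0) (u n) i) (u j) : ℝ) ≤ (17 : ℕ) := by exact_mod_cast hd
    push_cast at h
    exact ⟨y, hy, by linarith⟩
  · obtain ⟨i, hi, hxi⟩ := hSu x hx
    obtain ⟨_, ⟨j, hj, rfl⟩, hd⟩ := hf.exists_dist_path_le hu hi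
    have := pointDist_le hc x (vertex Γ (f (u 0) (u n) j)) (u i) (f (u 0) (u n) j)
    rw [distVertex_vertex, SimpleGraph.dist_self] at this
    have h : (Γ.dist (u i) (f (u 0) (u n) j) : ℝ) ≤ (34 : ℕ) := by exact_mod_cast hd
    push_cast at h this
    exact ⟨_, .inl ⟨j, hj, rfl⟩, by linarith⟩

end Realization

end MetricGraph

namespace Garside

/-! ### The Garside order, absorbable elements and meets -/

section GarsideOrder

variable {G : Type*} [Group G] {P : Submonoid G} {Δ : G}

/-- The prefix order of a Garside group, as a meet semilattice. -/
noncomputable abbrev IsGarsideGroup.semilatticeInf (h : IsGarsideGroup P Δ) : SemilatticeInf G where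
  le x y := Prefix P x y
  le_refl x := by simp [Prefix]
  le_trans x y z hxy hyz := by
    have := P.mul_mem hxy hyz
    rwa [mul_assoc, mul_inv_cancel_left] at this
  le_antisymm x y hxy hyx := by
    have := h.eq_one_of_inv_mem _ hxy (by simpa [Prefix] using hyx)
    exact inv_mul_eq_one.1 this
  inf x y := (h.exists_gcd x y).choose
  inf_le_left x y := (h.exists_gcd x y).choose_spec.1
  inf_le_right x y := (h.exists_gcd x y).choose_spec.2.1
  le_inf x y z hy hz := (h.exists_gcd y z).choose_spec.2.2 x hy hz

/-- The order of `G` is the prefix order of the Garside group `(G, P, Δ)`. -/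
structure IsGarsideOrder (P : Submonoid G) (Δ : G) [SemilatticeInf G] : Prop where
  isGarsideGroup : IsGarsideGroup P Δ
  prefix_iff : ∀ x y : G, Prefix P x y ↔ x ≤ y

/-- Two vertices of a graph are equal or adjacent. -/
def Near {V : Type*} (Γ : SimpleGraph V) (v w : V) : Prop := v = w ∨ Γ.Adj v w

theorem Near.symm {V : Type*} {Γ : SimpleGraph V} {v w : V} (h : Near Γ v w) : Near Γ w v :=
  h.imp Eq.symm SimpleGraph.Adj.symm

theorem Near.dist_le {V : Type*} {Γ : SimpleGraph V} {v w : V} (h : Near Γ v w) :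
    Γ.dist v w ≤ 1 := by
  rcases h with rfl | h
  · simp
  · exact (SimpleGraph.dist_eq_one_iff_adj.2 h).le

theorem Near.reachable {V : Type*} {Γ : SimpleGraph V} {v w : V} (h : Near Γ v w) :
    Γ.Reachable v w := by
  rcases h with rfl | h
  · exact .refl _
  · exact h.reachable

theorem coset_eq_iff {a b : G} : coset Δ a = coset Δ b ↔ ∃ k : ℤ, b = a * Δ ^ k := by
  unfold coset
  rw [QuotientGroup.eq, Subgroup.mem_zpowers_iff]
  exact exists_congr fun k => by rw [eq_inv_mul_iff_mul_eq, eq_comm]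

theorem coset_mul_zpow (a : G) (k : ℤ) : coset Δ (a * Δ ^ k) = coset Δ a :=
  (coset_eq_iff.2 ⟨k, rfl⟩).symm

namespace IsGarsideOrder

variable [SemilatticeInf G]

theorem one_le_iff (h : IsGarsideOrder P Δ) {x : G} : 1 ≤ x ↔ x ∈ P := by
  rw [← h.prefix_iff]; simp [Prefix]

theorem mul_le_mul_left_iff (h : IsGarsideOrder P Δ) (g : G) {x y : G} :
    g * x ≤ g * y ↔ x ≤ y := by
  rw [← h.prefix_iff, ← h.prefix_iff]
  simp [Prefix, mul_assoc]

theorem mul_le_iff (h : IsGarsideOrder P Δ) {g x y : G} : g * x ≤ y ↔ x ≤ g⁻¹ * y := by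
  rw [← h.mul_le_mul_left_iff g (y := g⁻¹ * y), mul_inv_cancel_left]

theorem le_mul_iff (h : IsGarsideOrder P Δ) {g x y : G} : x ≤ g * y ↔ g⁻¹ * x ≤ y := by
  rw [← h.mul_le_mul_left_iff g (x := g⁻¹ * x), mul_inv_cancel_left]

theorem mul_inf (h : IsGarsideOrder P Δ) (g x y : G) : g * (x ⊓ y) = g * x ⊓ g * y := by
  apply le_antisymm
  · exact le_inf ((h.mul_le_mul_left_iff g).2 inf_le_left)
      ((h.mul_le_mul_left_iff g).2 inf_le_right)
  · rw [h.le_mul_iff]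
    exact le_inf (h.le_mul_iff.1 inf_le_left) (h.le_mul_iff.1 inf_le_right)

/-- Right multiplication by `Δ` preserves the left-invariant order because conjugation by `Δ`
preserves `P`. -/
theorem mul_delta_le_iff (h : IsGarsideOrder P Δ) {x y : G} : x * Δ ≤ y * Δ ↔ x ≤ y := by
  rw [← h.prefix_iff, ← h.prefix_iff, Prefix, Prefix,
    ← h.isGarsideGroup.conj_mem_iff (x⁻¹ * y)]
  simp [mul_assoc]

theorem mul_zpow_le_iff (h : IsGarsideOrder P Δ) (k : ℤ) {x y : G} :
    x * Δ ^ k ≤ y * Δ ^ k ↔ x ≤ y := by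
  induction k using Int.induction_on with
  | zero => simp
  | succ n ih => rw [zpow_add_one, ← mul_assoc, ← mul_assoc, h.mul_delta_le_iff, ih]
  | pred n ih =>
    rw [← h.mul_delta_le_iff, mul_assoc, mul_assoc, ← zpow_add_one, sub_add_cancel, ih]

theorem inf_mul_zpow (h : IsGarsideOrder P Δ) (x y : G) (k : ℤ) :
    (x ⊓ y) * Δ ^ k = x * Δ ^ k ⊓ y * Δ ^ k := by
  apply le_antisymm
  · exact le_inf ((h.mul_zpow_le_iff k).2 inf_le_left) ((h.mul_zpow_le_iff k).2 inf_le_right)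
  · rw [← h.mul_zpow_le_iff (-k), mul_assoc (x ⊓ y), ← zpow_add, add_neg_cancel, zpow_zero,
      mul_one]
    refine le_inf ?_ ?_ <;> rw [← h.mul_zpow_le_iff k, mul_assoc, ← zpow_add, neg_add_cancel,
      zpow_zero, mul_one]
    · exact inf_le_left
    · exact inf_le_right

theorem one_le_zpow (h : IsGarsideOrder P Δ) {k : ℤ} (hk : 0 ≤ k) : 1 ≤ Δ ^ k := by
  lift k to ℕ using hk
  rw [h.one_le_iff, zpow_natCast]
  exact P.pow_mem h.isGarsideGroup.delta_mem k

theorem mul_zpow_mono (h : IsGarsideOrder P Δ) (x : G) {i j : ℤ} (hij : i ≤ j) :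
    x * Δ ^ i ≤ x * Δ ^ j := by
  have := h.one_le_zpow (sub_nonneg.2 hij)
  rw [← h.mul_le_mul_left_iff (x * Δ ^ i), mul_assoc, mul_assoc, ← zpow_add] at this
  simpa using this

theorem zpow_mono (h : IsGarsideOrder P Δ) {i j : ℤ} (hij : i ≤ j) : Δ ^ i ≤ Δ ^ j := by
  simpa using h.mul_zpow_mono 1 hij

theorem le_mul_zpow (h : IsGarsideOrder P Δ) (x : G) {k : ℤ} (hk : 0 ≤ k) : x ≤ x * Δ ^ k := by
  simpa using h.mul_zpow_mono x hk

theorem le_mul_of_one_le (h : IsGarsideOrder P Δ) (x : G) {y : G} (hy : 1 ≤ y) : x ≤ x * y := by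
  simpa using (h.mul_le_mul_left_iff x).2 hy

theorem conj_mem (h : IsGarsideOrder P Δ) (k : ℤ) {x : G} (hx : x ∈ P) :
    Δ ^ (-k) * x * Δ ^ k ∈ P := by
  rw [← h.one_le_iff, mul_assoc, h.le_mul_iff]
  simpa using (h.mul_zpow_le_iff k).2 (h.one_le_iff.2 hx)

theorem exists_zpow_le (h : IsGarsideOrder P Δ) (x : G) : ∃ k : ℤ, Δ ^ k ≤ x := by
  have hx : x ∈ Subgroup.closure {s | IsSimple P Δ s} := by
    rw [h.isGarsideGroup.closure_simple]; trivial
  induction hx using Subgroup.closure_induction_right with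
  | one => exact ⟨0, by simp⟩
  | mul_right x _ s hs ih =>
    obtain ⟨k, hk⟩ := ih
    exact ⟨k, hk.trans (h.le_mul_of_one_le x (h.one_le_iff.2 hs.1))⟩
  | mul_inv_cancel x _ s hs ih =>
    obtain ⟨k, hk⟩ := ih
    refine ⟨k - 1, ?_⟩
    have h1 : x ≤ x * (s⁻¹ * Δ) := h.le_mul_of_one_le x (h.one_le_iff.2 hs.2.1)
    rw [← h.mul_delta_le_iff, ← zpow_add_one, sub_add_cancel, mul_assoc]
    exact hk.trans h1

theorem exists_le_zpow (h : IsGarsideOrder P Δ) (x : G) : ∃ k : ℤ, x ≤ Δ ^ k := by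
  obtain ⟨k, hk⟩ := h.exists_zpow_le x⁻¹
  refine ⟨-k, ?_⟩
  rw [← h.mul_zpow_le_iff k, ← zpow_add, neg_add_cancel, zpow_zero, h.mul_le_iff, mul_one]
  exact hk

/-- A failure would force `Δ = 1`; since every element lies between two powers of `Δ`, the group
would be trivial. -/
theorem zpow_le_zpow_iff (h : IsGarsideOrder P Δ) [Nontrivial G] {i j : ℤ} :
    Δ ^ i ≤ Δ ^ j ↔ i ≤ j := by
  refine ⟨fun hij => ?_, h.zpow_mono⟩
  by_contra! hlt
  have h1 : Δ ^ (j + 1) ≤ Δ ^ j := (h.zpow_mono hlt).trans hij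
  have h2 : Δ = 1 := by
    rw [zpow_add_one] at h1
    have h3 := h1.antisymm (by simpa using h.le_mul_zpow (Δ ^ j) zero_le_one)
    simpa using h3
  obtain ⟨x, hx⟩ := exists_ne (1 : G)
  obtain ⟨k, hk⟩ := h.exists_zpow_le x
  obtain ⟨l, hl⟩ := h.exists_le_zpow x
  rw [h2, one_zpow] at hk hl
  exact hx (hl.antisymm hk)

theorem le_inf_iff (h : IsGarsideOrder P Δ) [Nontrivial G] {r : ℤ} {x : G} :
    r ≤ inf P Δ x ↔ Δ ^ r ≤ x := by
  have hset : {r : ℤ | Prefix P (Δ ^ r) x} = {r : ℤ | Δ ^ r ≤ x} :=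
    Set.ext fun r => h.prefix_iff _ _
  have hne : {r : ℤ | Δ ^ r ≤ x}.Nonempty := h.exists_zpow_le x
  have hbdd : BddAbove {r : ℤ | Δ ^ r ≤ x} := by
    obtain ⟨l, hl⟩ := h.exists_le_zpow x
    exact ⟨l, fun r hr => h.zpow_le_zpow_iff.1 (le_trans hr hl)⟩
  rw [inf, hset]
  exact ⟨fun hr => (h.zpow_mono hr).trans (Int.csSup_mem hne hbdd), fun hr => le_csSup hbdd hr⟩

theorem sup_le_iff (h : IsGarsideOrder P Δ) [Nontrivial G] {r : ℤ} {x : G} :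
    sup P Δ x ≤ r ↔ x ≤ Δ ^ r := by
  have hset : {r : ℤ | Prefix P x (Δ ^ r)} = {r : ℤ | x ≤ Δ ^ r} :=
    Set.ext fun r => h.prefix_iff _ _
  have hne : {r : ℤ | x ≤ Δ ^ r}.Nonempty := h.exists_le_zpow x
  have hbdd : BddBelow {r : ℤ | x ≤ Δ ^ r} := by
    obtain ⟨l, hl⟩ := h.exists_zpow_le x
    exact ⟨l, fun r hr => h.zpow_le_zpow_iff.1 (le_trans hl hr)⟩
  rw [sup, hset]
  exact ⟨fun hr => le_trans (Int.csInf_mem hne hbdd) (h.zpow_mono hr), fun hr => csInf_le hbdd hr⟩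

theorem mul_zpow_le_iff_le_inf (h : IsGarsideOrder P Δ) [Nontrivial G] {r : ℤ} {g x : G} :
    g * Δ ^ r ≤ x ↔ r ≤ inf P Δ (g⁻¹ * x) := by
  rw [h.le_inf_iff, h.mul_le_iff]

theorem le_mul_zpow_iff_sup_le (h : IsGarsideOrder P Δ) [Nontrivial G] {r : ℤ} {g x : G} :
    x ≤ g * Δ ^ r ↔ sup P Δ (g⁻¹ * x) ≤ r := by
  rw [h.sup_le_iff, h.le_mul_iff]

theorem inf_mul_zpow_right (h : IsGarsideOrder P Δ) [Nontrivial G] (x : G) (k : ℤ) :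
    inf P Δ (x * Δ ^ k) = inf P Δ x + k := by
  refine eq_of_forall_le_iff fun r => ?_
  rw [← sub_le_iff_le_add, h.le_inf_iff, h.le_inf_iff, ← h.mul_zpow_le_iff k (y := x), ← zpow_add,
    sub_add_cancel]

theorem conj_zpow_le_iff (h : IsGarsideOrder P Δ) (k r : ℤ) (x : G) :
    Δ ^ r ≤ Δ ^ (-k) * x * Δ ^ k ↔ Δ ^ r ≤ x := by
  rw [← h.mul_zpow_le_iff k (y := x), mul_assoc, h.le_mul_iff, ← zpow_neg, neg_neg, ← zpow_add,
    ← zpow_add, add_comm]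

theorem conj_le_zpow_iff (h : IsGarsideOrder P Δ) (k r : ℤ) (x : G) :
    Δ ^ (-k) * x * Δ ^ k ≤ Δ ^ r ↔ x ≤ Δ ^ r := by
  rw [← h.mul_zpow_le_iff k (x := x), mul_assoc, h.mul_le_iff, ← zpow_neg, neg_neg, ← zpow_add,
    ← zpow_add, add_comm]

theorem inf_conj (h : IsGarsideOrder P Δ) [Nontrivial G] (x : G) (k : ℤ) :
    inf P Δ (Δ ^ (-k) * x * Δ ^ k) = inf P Δ x :=
  eq_of_forall_le_iff fun r => by rw [h.le_inf_iff, h.le_inf_iff, h.conj_zpow_le_iff]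

theorem sup_conj (h : IsGarsideOrder P Δ) [Nontrivial G] (x : G) (k : ℤ) :
    sup P Δ (Δ ^ (-k) * x * Δ ^ k) = sup P Δ x :=
  eq_of_forall_ge_iff fun r => by rw [h.sup_le_iff, h.sup_le_iff, h.conj_le_zpow_iff]

theorem isAbsorbable_conj (h : IsGarsideOrder P Δ) [Nontrivial G] {y : G}
    (hy : IsAbsorbable P Δ y) (k : ℤ) : IsAbsorbable P Δ (Δ ^ (-k) * y * Δ ^ k) := by
  obtain ⟨h0, x, h1, h2⟩ := hy
  refine ⟨by rwa [h.inf_conj, h.sup_conj], Δ ^ (-k) * x * Δ ^ k, ?_⟩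
  have : Δ ^ (-k) * x * Δ ^ k * (Δ ^ (-k) * y * Δ ^ k) = Δ ^ (-k) * (x * y) * Δ ^ k := by group
  rw [this, h.inf_conj, h.sup_conj, h.inf_conj, h.sup_conj]
  exact ⟨h1, h2⟩

theorem isSimple_conj (h : IsGarsideOrder P Δ) {s : G} (hs : IsSimple P Δ s) (k : ℤ) :
    IsSimple P Δ (Δ ^ (-k) * s * Δ ^ k) := by
  refine ⟨h.conj_mem k hs.1, ?_, ?_⟩
  · convert h.conj_mem k hs.2.1 using 1; group
  · convert h.conj_mem k hs.2.2 using 1; group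

theorem isSimple_iff (h : IsGarsideOrder P Δ) {s : G} : IsSimple P Δ s ↔ 1 ≤ s ∧ s ≤ Δ := by
  rw [IsSimple, ← h.one_le_iff, ← h.one_le_iff, ← h.mul_le_iff (g := s), mul_one]
  refine ⟨fun hs => ⟨hs.1, hs.2.1⟩, fun hs => ⟨hs.1, hs.2, ?_⟩⟩
  have h1 : 1 ≤ s⁻¹ * Δ := h.mul_le_iff.1 (by rw [mul_one]; exact hs.2)
  have := h.conj_mem (-1) (h.one_le_iff.1 h1)
  convert this using 1; group

theorem near_coset (h : IsGarsideOrder P Δ) [Nontrivial G] (g m : G)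
    (hm : IsSimple P Δ m ∨ IsAbsorbable P Δ m) :
    Near (additionalLengthComplex P Δ) (coset Δ g) (coset Δ (g * m)) := by
  by_cases heq : coset Δ g = coset Δ (g * m)
  · exact .inl heq
  refine .inr ⟨heq, .inl ?_⟩
  -- The distinguished representative is `g * Δ ^ k`, so the label of the edge is `m` conjugated by
  -- `Δ ^ k`.
  obtain ⟨k, hk⟩ := coset_eq_iff.1 (coset_rep P Δ (coset Δ g)).symm
  have hcos : coset Δ (rep P Δ (coset Δ g) * (Δ ^ (-k) * m * Δ ^ k)) = coset Δ (g * m) := by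
    rw [hk]
    have : g * Δ ^ k * (Δ ^ (-k) * m * Δ ^ k) = g * m * Δ ^ k := by group
    rw [this, coset_mul_zpow]
  rcases hm with hm | hm
  · refine .inl ⟨_, h.isSimple_conj hm k, fun h1 => heq ?_, fun h1 => heq ?_, hcos⟩
    · rw [← hcos, h1, mul_one, coset_rep]
    · have := coset_mul_zpow (Δ := Δ) (rep P Δ (coset Δ g)) 1
      rw [zpow_one, coset_rep] at this
      rw [← hcos, h1, this]
  · exact .inr ⟨_, h.isAbsorbable_conj hm k, hcos⟩

/-- The element `g⁻¹ * p` absorbs `p⁻¹ * q`: `hlo` and `hhi` say that infimum and supremum do not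
change. Moreover `p⁻¹ * q` has infimum `0`, since `p * Δ ≤ q` would raise the infimum of `g⁻¹ * q`
above that of `g⁻¹ * p`. -/
theorem near_of_absorb (h : IsGarsideOrder P Δ) [Nontrivial G] {p q : G} (g : G) (hpq : p ≤ q)
    (hlo : ∀ r : ℤ, g * Δ ^ r ≤ q → g * Δ ^ r ≤ p) (hhi : ∀ r : ℤ, p ≤ g * Δ ^ r → q ≤ g * Δ ^ r) :
    Near (additionalLengthComplex P Δ) (coset Δ p) (coset Δ q) := by
  have hq : p * (p⁻¹ * q) = q := mul_inv_cancel_left _ _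
  rw [← hq]
  refine h.near_coset p _ (.inr ⟨.inl ?_, g⁻¹ * p, ?_, ?_⟩)
  · refine eq_of_forall_le_iff fun r => ?_
    rw [← h.mul_zpow_le_iff_le_inf]
    refine ⟨fun hr => ?_, fun hr => le_trans ?_ hpq⟩
    · by_contra! hr0
      have h1 := h.mul_zpow_le_iff_le_inf.2 (le_refl (inf P Δ (g⁻¹ * p)))
      have h2 : g * Δ ^ (inf P Δ (g⁻¹ * p) + 1) ≤ p := by
        apply hlo
        refine le_trans ?_ ((h.mul_zpow_mono p (show 1 ≤ r from hr0)).trans hr)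
        rw [zpow_add, ← mul_assoc, h.mul_zpow_le_iff]
        exact h1
      rw [h.mul_zpow_le_iff_le_inf] at h2
      omega
    · simpa using h.mul_zpow_mono p hr
  · rw [mul_assoc, hq]
    refine eq_of_forall_le_iff fun r => ?_
    rw [← h.mul_zpow_le_iff_le_inf, ← h.mul_zpow_le_iff_le_inf]
    exact ⟨hlo r, fun hr => hr.trans hpq⟩
  · rw [mul_assoc, hq]
    refine eq_of_forall_ge_iff fun r => ?_
    rw [← h.le_mul_zpow_iff_sup_le, ← h.le_mul_zpow_iff_sup_le]
    exact ⟨fun hr => hpq.trans hr, hhi r⟩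

/-- Absorption with supremum `0`: as `p ≤ q ≤ g` and `p` is not below `g * Δ⁻¹`, both `g⁻¹ * p` and
`g⁻¹ * q` have supremum `0`. -/
theorem near_of_le (h : IsGarsideOrder P Δ) [Nontrivial G] {p q g : G} (hpq : p ≤ q) (hqg : q ≤ g)
    (hlo : ∀ r : ℤ, g * Δ ^ r ≤ q → g * Δ ^ r ≤ p) (hp : ¬ p ≤ g * Δ ^ (-1 : ℤ)) :
    Near (additionalLengthComplex P Δ) (coset Δ p) (coset Δ q) := by
  refine h.near_of_absorb g hpq hlo fun r hr => ?_
  rcases le_or_gt 0 r with h0 | h0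
  · exact hqg.trans (h.le_mul_zpow g h0)
  · exact absurd (hr.trans (h.mul_zpow_mono g (by omega))) hp

theorem le_mul_zpow_neg_one (h : IsGarsideOrder P Δ) {d b : G} (hdb : d ⊓ b ≤ b * Δ ^ (-1 : ℤ)) :
    d ≤ b * Δ ^ (-1 : ℤ) := by
  have main : ∀ n : ℕ, d ≤ b * Δ ^ (n : ℤ) → d ≤ b * Δ ^ (-1 : ℤ) := by
    intro n
    induction n with
    | zero =>
      intro hd
      rw [Nat.cast_zero, zpow_zero, mul_one] at hd
      rwa [inf_eq_left.2 hd] at hdb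
    | succ n ih =>
      intro hd
      apply ih
      -- Multiplied by `Δ ^ (n + 1)`, the hypothesis improves an upper bound `b * Δ ^ (n + 1)` of
      -- `d` to `b * Δ ^ n`.
      rw [← h.mul_zpow_le_iff (n + 1 : ℕ), h.inf_mul_zpow, mul_assoc, ← zpow_add] at hdb
      have := (le_inf (h.le_mul_zpow d (Int.natCast_nonneg _)) hd).trans hdb
      simpa using this
  obtain ⟨k, hk⟩ := h.exists_le_zpow (b⁻¹ * d)
  rw [← h.le_mul_iff] at hk
  exact main k.toNat (hk.trans (h.mul_zpow_mono b (Int.self_le_toNat k)))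

/-- With `c` normalized by `h1` and `h2`, the route depends on `m = a ⊓ b ⊓ c`. If `m` is not below
`b * Δ⁻¹`, pass from `a ⊓ b` through `m` to `b ⊓ c`, absorbing from `b`. If it is below `b * Δ⁻¹`
but not below `a * Δ⁻¹`, then `m = a ⊓ c` is one step away, absorbing from `a`. If it is below both,
then `c * Δ ≤ a ⊓ b`, and the largest `c * Δ ^ n` below `a ⊓ b` is one step away. -/
theorem exists_near_near_aux (h : IsGarsideOrder P Δ) [Nontrivial G] {a b c : G}
    (h1 : ∀ r : ℤ, a * Δ ^ r ≤ b → a * Δ ^ r ≤ c)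
    (h2 : ∀ r : ℤ, b * Δ ^ r ≤ a ↔ b * Δ ^ r ≤ c) :
    ∃ k : ℤ, ∃ z, (z = coset Δ (a ⊓ c * Δ ^ k) ∨ z = coset Δ (b ⊓ c * Δ ^ k)) ∧
      ∃ y, Near (additionalLengthComplex P Δ) (coset Δ (a ⊓ b)) y ∧
        Near (additionalLengthComplex P Δ) y z := by
  by_cases hb : a ⊓ b ⊓ c ≤ b * Δ ^ (-1 : ℤ)
  swap
  · refine ⟨0, coset Δ (b ⊓ c), .inr (by simp), coset Δ (a ⊓ b ⊓ c), ?_, ?_⟩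
    · refine (h.near_of_le inf_le_left inf_le_right (fun r hr => ?_) hb).symm
      exact le_inf hr ((h2 r).1 (hr.trans inf_le_left))
    · refine h.near_of_le (le_inf (inf_le_left.trans inf_le_right) inf_le_right) inf_le_left
        (fun r hr => ?_) hb
      exact le_inf (le_inf ((h2 r).2 (hr.trans inf_le_right)) (hr.trans inf_le_left))
        (hr.trans inf_le_right)
  by_cases ha : a ⊓ b ⊓ c ≤ a * Δ ^ (-1 : ℤ)
  swap
  · have hac : a ⊓ c ≤ b := by
      have := h.le_mul_zpow_neg_one (d := a ⊓ c) (b := b) (by rwa [inf_right_comm])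
      exact this.trans (by simpa using h.mul_zpow_mono b (show (-1 : ℤ) ≤ 0 by norm_num))
    have hm : a ⊓ b ⊓ c = a ⊓ c := by rw [inf_right_comm]; exact inf_eq_left.2 hac
    rw [hm] at ha
    refine ⟨0, coset Δ (a ⊓ c), .inl (by simp), coset Δ (a ⊓ c), ?_, .inl rfl⟩
    exact (h.near_of_le (le_inf inf_le_left hac) inf_le_left
      (fun r hr => le_inf (hr.trans inf_le_left) (h1 r (hr.trans inf_le_right))) ha).symm
  · have hc : c ≤ (a ⊓ b) * Δ ^ (-1 : ℤ) := h.le_mul_zpow_neg_one (by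
      rw [h.inf_mul_zpow, inf_comm]; exact le_inf ha hb)
    have hc' : c * Δ ^ (1 : ℤ) ≤ a ⊓ b := by
      rw [← h.mul_zpow_le_iff (-1), mul_assoc, ← zpow_add]; simpa using hc
    set n := inf P Δ (c⁻¹ * (a ⊓ b)) with hn
    have hn1 : 1 ≤ n := h.mul_zpow_le_iff_le_inf.1 hc'
    have hn2 : c * Δ ^ n ≤ a ⊓ b := h.mul_zpow_le_iff_le_inf.2 le_rfl
    have hcn : c ≤ c * Δ ^ n := h.le_mul_zpow c (by omega)
    have hn3 : ¬ c * Δ ^ n ≤ (a ⊓ b) * Δ ^ (-1 : ℤ) := fun hle => by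
      rw [← h.mul_zpow_le_iff 1, mul_assoc, mul_assoc, ← zpow_add, ← zpow_add] at hle
      have := h.mul_zpow_le_iff_le_inf.1 (show c * Δ ^ (n + 1) ≤ a ⊓ b by simpa using hle)
      omega
    refine ⟨n, coset Δ (c * Δ ^ n), .inl (by rw [inf_eq_right.2 (hn2.trans inf_le_left)]),
      coset Δ (c * Δ ^ n), Near.symm ?_, .inl rfl⟩
    -- By maximality of `n`, `c * Δ ^ n` cannot lie below both `a * Δ⁻¹` and `b * Δ⁻¹`; absorption
    -- is from the one that fails.
    by_cases hna : c * Δ ^ n ≤ a * Δ ^ (-1 : ℤ)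
    · refine h.near_of_le (g := b) hn2 inf_le_right
        (fun r hr => ((h2 r).1 (hr.trans inf_le_left)).trans hcn) fun hnb => hn3 ?_
      rw [h.inf_mul_zpow]
      exact le_inf hna hnb
    · exact h.near_of_le (g := a) hn2 inf_le_left
        (fun r hr => (h1 r (hr.trans inf_le_right)).trans hcn) hna

/-- Replacing `c` by `c * Δ ^ s` shifts the infima of `a⁻¹ * c` and `b⁻¹ * c` by the same `s`. The
larger of the two shifts that match `a⁻¹ * b` and `b⁻¹ * a` respectively achieves the normalization,
up to exchanging `a` and `b`. -/
theorem exists_near_near (h : IsGarsideOrder P Δ) [Nontrivial G] (a b c : G) :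
    ∃ k : ℤ, ∃ z, (z = coset Δ (a ⊓ c * Δ ^ k) ∨ z = coset Δ (b ⊓ c * Δ ^ k)) ∧
      ∃ y, Near (additionalLengthComplex P Δ) (coset Δ (a ⊓ b)) y ∧
        Near (additionalLengthComplex P Δ) y z := by
  have main : ∀ a b : G, inf P Δ (a⁻¹ * b) - inf P Δ (a⁻¹ * c) ≤
      inf P Δ (b⁻¹ * a) - inf P Δ (b⁻¹ * c) →
      ∃ k : ℤ, ∃ z, (z = coset Δ (a ⊓ c * Δ ^ k) ∨ z = coset Δ (b ⊓ c * Δ ^ k)) ∧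
      ∃ y, Near (additionalLengthComplex P Δ) (coset Δ (a ⊓ b)) y ∧
        Near (additionalLengthComplex P Δ) y z := by
    intro a b hab
    obtain ⟨k, hk⟩ := h.exists_near_near_aux (a := a) (b := b)
      (c := c * Δ ^ (inf P Δ (b⁻¹ * a) - inf P Δ (b⁻¹ * c)))
      (fun r hr => by
        rw [h.mul_zpow_le_iff_le_inf] at hr ⊢
        rw [← mul_assoc, h.inf_mul_zpow_right]
        omega)
      (fun r => by
        rw [h.mul_zpow_le_iff_le_inf, h.mul_zpow_le_iff_le_inf, ← mul_assoc,
          h.inf_mul_zpow_right, add_sub_cancel])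
    rw [mul_assoc, ← zpow_add] at hk
    exact ⟨_, hk⟩
  rcases le_total (inf P Δ (a⁻¹ * b) - inf P Δ (a⁻¹ * c))
    (inf P Δ (b⁻¹ * a) - inf P Δ (b⁻¹ * c)) with hab | hab
  · exact main a b hab
  · obtain ⟨k, z, hz, hy⟩ := main b a hab
    exact ⟨k, z, hz.symm, by rwa [inf_comm a b]⟩

end IsGarsideOrder
end GarsideOrder
-- Normal forms and preferred paths as families of meets
section PreferredPaths

variable {G : Type*} [Group G] {P : Submonoid G} {Δ : G}

theorem preferredVertex_zero (v w : Vertex Δ) : preferredVertex P Δ v w 0 = v := by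
  simp [preferredVertex, coset_rep]

namespace IsGarsideOrder

variable [SemilatticeInf G]

theorem one_le_prod (h : IsGarsideOrder P Δ) {l : List G} (hl : ∀ s ∈ l, 1 ≤ s) : 1 ≤ l.prod :=
  h.one_le_iff.2 (P.list_prod_mem fun s hs => h.one_le_iff.1 (hl s hs))

theorem delta_zpow_le_mul (h : IsGarsideOrder P Δ) {s : G} (hs : 1 ≤ s) (k : ℤ) :
    Δ ^ k ≤ s * Δ ^ k := by
  simpa using (h.mul_zpow_le_iff k).2 hs

theorem leftWeighted_iff (h : IsGarsideOrder P Δ) {s t : G} (hs : s ≤ Δ) (ht : 1 ≤ t) :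
    LeftWeighted P Δ s t ↔ s⁻¹ * Δ ⊓ t = 1 := by
  simp only [LeftWeighted, IsGcd, h.prefix_iff]
  constructor
  · rintro ⟨h1, h2, h3⟩
    exact le_antisymm (h3 _ inf_le_left inf_le_right) (le_inf h1 h2)
  · intro heq
    refine ⟨?_, ht, fun c h1 h2 => heq ▸ le_inf h1 h2⟩
    rw [← h.mul_le_iff]; simpa using hs

theorem one_le_of_isLeftNormalForm (h : IsGarsideOrder P Δ) {x : G} {l : List G}
    (hl : IsLeftNormalForm P Δ x l) : 1 ≤ x :=
  hl.2.2 ▸ h.one_le_prod fun s hs => (h.isSimple_iff.1 (hl.1 s hs).1).1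

/-- The partial products of a left normal form are the meets with the powers of `Δ`. -/
theorem take_prod_eq (h : IsGarsideOrder P Δ) : ∀ {l : List G} {x : G},
    IsLeftNormalForm P Δ x l → ∀ i : ℕ, i ≤ l.length → (l.take i).prod = x ⊓ Δ ^ (i : ℤ) := by
  intro l
  induction l with
  | nil =>
    rintro x ⟨-, -, rfl⟩ i hi
    obtain rfl : i = 0 := by simpa using hi
    simp
  | cons s t ih =>
    rintro x ⟨h1, h2, rfl⟩ i hi
    have ht : IsLeftNormalForm P Δ t.prod t :=
      ⟨fun a ha => h1 a (List.mem_cons_of_mem _ ha), h2.tail, rfl⟩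
    have hs := h.isSimple_iff.1 (h1 s List.mem_cons_self).1
    have hone := h.one_le_of_isLeftNormalForm ht
    have hsd : s⁻¹ * Δ ≤ Δ := by
      rw [← h.le_mul_iff]
      simpa using h.delta_zpow_le_mul hs.1 1
    -- Since `s⁻¹ * Δ ≤ Δ`, only the meet of the tail with `Δ` matters, which is its first letter;
    -- left-weightedness applies.
    have hhead : s⁻¹ * Δ ⊓ t.prod = 1 := by
      cases t with
      | nil =>
        rw [List.prod_nil, inf_eq_right, ← h.mul_le_iff]
        simpa using hs.2
      | cons a t =>
        have ha := h.isSimple_iff.1 (h1 a (by simp)).1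
        have h3 := ih ht 1 (by simp)
        have h4 := (h.leftWeighted_iff hs.2 ha.1).1 (List.isChain_cons_cons.1 h2).1
        simp only [List.take_succ_cons, List.take_zero, List.prod_cons, List.prod_nil, mul_one,
          Nat.cast_one, zpow_one] at h3
        rw [h3, ← inf_assoc, inf_eq_left.2 (inf_le_left.trans hsd)] at h4
        rwa [List.prod_cons]
    have hxs : s * t.prod ⊓ Δ = s := by
      have := h.mul_inf s (s⁻¹ * Δ) t.prod
      rw [hhead, mul_one, mul_inv_cancel_left] at this
      rw [inf_comm]; exact this.symm
    cases i with
    | zero =>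
      rw [List.take_zero, List.prod_nil, Nat.cast_zero, zpow_zero, List.prod_cons]
      exact (inf_eq_right.2 (hs.1.trans (h.le_mul_of_one_le s hone))).symm
    | succ i =>
      rw [List.take_succ_cons, List.prod_cons, List.prod_cons, ih ht i (by simpa using hi),
        h.mul_inf]
      -- This is `s = x ⊓ Δ` multiplied by `Δ ^ i`, where `x = s * t.prod`; the first term of the
      -- meet is then redundant next to `x`.
      have hsi : s * Δ ^ (i : ℤ) = s * t.prod * Δ ^ (i : ℤ) ⊓ Δ ^ ((i + 1 : ℕ) : ℤ) := by
        have := h.inf_mul_zpow (s * t.prod) Δ i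
        rw [hxs, ← zpow_one_add] at this
        rw [this]; congr 2; push_cast; ring
      rw [hsi, ← inf_assoc, inf_eq_left.2 (h.le_mul_zpow _ (Int.natCast_nonneg i))]

/-- The greedy algorithm: split off `x ⊓ Δ`. This lowers an upper bound `Δ ^ (n + 1)` of `x` to `Δ ^
n` for the remainder. -/
theorem exists_isLeftNormalForm (h : IsGarsideOrder P Δ) {x : G} (hx : 1 ≤ x) (hΔ : ¬ Δ ≤ x) :
    ∃ l, IsLeftNormalForm P Δ x l := by
  have main : ∀ (n : ℕ) (x : G), 1 ≤ x → ¬ Δ ≤ x → x ≤ Δ ^ (n : ℤ) →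
      ∃ l, IsLeftNormalForm P Δ x l := by
    intro n
    induction n with
    | zero =>
      intro x h1 h2 h3
      have : x = 1 := le_antisymm (by simpa using h3) h1
      exact ⟨[], by simp, List.isChain_nil, by simp [this]⟩
    | succ n ih =>
      intro x h1 h2 h3
      have hy3 : (x ⊓ Δ)⁻¹ * x ≤ Δ ^ (n : ℤ) := by
        rw [← h.le_mul_iff, h.inf_mul_zpow, ← zpow_one_add]
        refine le_inf (h.le_mul_zpow x (Int.natCast_nonneg n)) (h3.trans (le_of_eq ?_))
        congr 1; push_cast; ring
      have hy1 : 1 ≤ (x ⊓ Δ)⁻¹ * x := h.mul_le_iff.1 (by rw [mul_one]; exact inf_le_left)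
      have hs1 : 1 ≤ x ⊓ Δ := le_inf h1 (h.one_le_iff.2 h.isGarsideGroup.delta_mem)
      have hy2 : ¬ Δ ≤ (x ⊓ Δ)⁻¹ * x := fun hle => h2 (by
        have := h.delta_zpow_le_mul hs1 1
        rw [zpow_one] at this
        exact this.trans (h.le_mul_iff.2 (by rwa [inv_mul_cancel_left]) |>.trans
          (le_of_eq (mul_inv_cancel_left _ _))))
      obtain ⟨l, hl⟩ := ih _ hy1 hy2 hy3
      by_cases hs : x ⊓ Δ = 1
      · rw [hs, inv_one, one_mul] at hl
        exact ⟨l, hl⟩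
      · refine ⟨(x ⊓ Δ) :: l, ?_, ?_, ?_⟩
        · intro a ha
          rcases List.mem_cons.1 ha with rfl | ha
          · exact ⟨h.isSimple_iff.2 ⟨hs1, inf_le_right⟩, hs,
              fun heq => h2 (inf_eq_right.1 heq)⟩
          · exact hl.1 a ha
        · refine List.isChain_cons.2 ⟨fun t ht => ?_, hl.2.1⟩
          have hmem : t ∈ l := List.mem_of_mem_head? ht
          have ht1 := (h.isSimple_iff.1 (hl.1 t hmem).1)
          rw [h.leftWeighted_iff inf_le_right ht1.1]
          refine le_antisymm ?_ (le_inf (h.mul_le_iff.1 (by simp)) ht1.1)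
          have hty : t ≤ (x ⊓ Δ)⁻¹ * x := by
            cases l with
            | nil => simp at hmem
            | cons b l =>
              obtain rfl : b = t := by simpa using ht
              rw [← hl.2.2, List.prod_cons]
              exact h.le_mul_of_one_le b (h.one_le_prod fun s hs =>
                (h.isSimple_iff.1 (hl.1 s (List.mem_cons_of_mem _ hs)).1).1)
          refine (inf_le_inf_left _ hty).trans ?_
          rw [← h.mul_inf, inf_comm Δ x, inv_mul_cancel]
        · rw [List.prod_cons, hl.2.2, mul_inv_cancel_left]
  obtain ⟨k, hk⟩ := h.exists_le_zpow x
  exact main k.toNat x hx hΔ (hk.trans (h.zpow_mono (Int.self_le_toNat k)))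

theorem inf_rep (h : IsGarsideOrder P Δ) [Nontrivial G] (v : Vertex Δ) :
    inf P Δ (rep P Δ v) = 0 := by
  rw [rep, h.inf_mul_zpow_right, add_neg_cancel]

theorem one_le_rep (h : IsGarsideOrder P Δ) [Nontrivial G] (v : Vertex Δ) : 1 ≤ rep P Δ v := by
  have := h.le_inf_iff.1 (h.inf_rep v).ge
  rwa [zpow_zero] at this

theorem not_delta_le_rep (h : IsGarsideOrder P Δ) [Nontrivial G] (v : Vertex Δ) :
    ¬ Δ ≤ rep P Δ v := fun hle => by
  have := h.le_inf_iff.2 ((zpow_one Δ).le.trans hle)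
  rw [h.inf_rep] at this
  omega

theorem isLeftNormalForm_preferredWord (h : IsGarsideOrder P Δ) [Nontrivial G] (v w : Vertex Δ) :
    IsLeftNormalForm P Δ (rep P Δ (coset Δ ((rep P Δ v)⁻¹ * rep P Δ w))) (preferredWord P Δ v w) :=
  Classical.epsilon_spec (h.exists_isLeftNormalForm (h.one_le_rep _) (h.not_delta_le_rep _))

/-- The vertices of the preferred path are meets of representatives. -/
theorem exists_preferredVertex_eq (h : IsGarsideOrder P Δ) [Nontrivial G] (v w : Vertex Δ) {b : G}
    (hb : coset Δ b = w) : ∃ k : ℤ,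
      (∀ i ≤ (preferredWord P Δ v w).length,
        preferredVertex P Δ v w i = coset Δ (b * Δ ^ k ⊓ rep P Δ v * Δ ^ (i : ℤ))) ∧
      rep P Δ v ≤ b * Δ ^ k ∧
      b * Δ ^ k ≤ rep P Δ v * Δ ^ ((preferredWord P Δ v w).length : ℤ) := by
  have hl := h.isLeftNormalForm_preferredWord v w
  set l := preferredWord P Δ v w with hldef
  set x := rep P Δ (coset Δ ((rep P Δ v)⁻¹ * rep P Δ w)) with hx
  obtain ⟨k₁, hk₁⟩ := coset_eq_iff.1 (coset_rep P Δ (coset Δ ((rep P Δ v)⁻¹ * rep P Δ w))).symm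
  obtain ⟨k₂, hk₂⟩ := coset_eq_iff.1 (hb.trans (coset_rep P Δ w).symm)
  have hbx : b * Δ ^ (k₂ + k₁) = rep P Δ v * x := by
    rw [hx, hk₁, hk₂, zpow_add]; group
  refine ⟨k₂ + k₁, fun i hi => ?_, ?_, ?_⟩
  · rw [preferredVertex, ← hldef, h.take_prod_eq hl i hi, hbx, h.mul_inf]
  · rw [hbx]; exact h.le_mul_of_one_le _ (h.one_le_rep _)
  · rw [hbx, h.mul_le_mul_left_iff]
    have := h.take_prod_eq hl l.length le_rfl
    rw [List.take_length, hl.2.2] at this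
    exact inf_eq_left.1 this.symm

/-- The description is independent of the representatives, as changing them only shifts `i`.
Exponents outside the range of the path give its two ends. -/
theorem mem_pathSet_iff (h : IsGarsideOrder P Δ) [Nontrivial G] {v w x : Vertex Δ} {a b : G}
    (ha : coset Δ a = v) (hb : coset Δ b = w) :
    x ∈ MetricGraph.pathSet (preferredVertex P Δ) (fun v w => (preferredWord P Δ v w).length) v w ↔
      ∃ i : ℤ, x = coset Δ (b ⊓ a * Δ ^ i) := by
  obtain ⟨k, hk, hk0, hkl⟩ := h.exists_preferredVertex_eq v w hb
  set n := (preferredWord P Δ v w).length with hn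
  obtain ⟨j, hj⟩ := coset_eq_iff.1 (ha.trans (coset_rep P Δ v).symm)
  have hshift : ∀ i : ℤ, coset Δ (b * Δ ^ k ⊓ rep P Δ v * Δ ^ i) =
      coset Δ (b ⊓ a * Δ ^ (j + i - k)) := fun i => by
    rw [← coset_mul_zpow (b ⊓ a * Δ ^ (j + i - k)) k, h.inf_mul_zpow, hj, mul_assoc, mul_assoc,
      ← zpow_add, ← zpow_add, sub_add_cancel]
  constructor
  · rintro ⟨i, hi, rfl⟩
    exact ⟨_, by rw [hk i hi, hshift]⟩
  · rintro ⟨i, rfl⟩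
    have hi := hshift (i + k - j)
    rw [show j + (i + k - j) - k = i by ring] at hi
    rw [← hi]
    rcases lt_or_ge (i + k - j) 0 with h0 | h0
    · refine ⟨0, Nat.zero_le _, ?_⟩
      have h1 := h.mul_zpow_mono (rep P Δ v) h0.le
      rw [zpow_zero, mul_one] at h1
      rw [hk 0 (Nat.zero_le _), inf_eq_right.2 (h1.trans hk0), Nat.cast_zero, zpow_zero, mul_one,
        inf_eq_right.2 hk0, coset_mul_zpow]
    rcases lt_or_ge (n : ℤ) (i + k - j) with h1 | h1
    · refine ⟨n, le_rfl, ?_⟩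
      rw [hk n le_rfl, inf_eq_left.2 hkl, inf_eq_left.2 (hkl.trans (h.mul_zpow_mono _ h1.le))]
    · refine ⟨(i + k - j).toNat, by simp only []; omega, ?_⟩
      rw [hk _ (by omega), Int.toNat_of_nonneg h0]

theorem near_preferredVertex_succ (h : IsGarsideOrder P Δ) [Nontrivial G] (v w : Vertex Δ) {i : ℕ}
    (hi : i < (preferredWord P Δ v w).length) : Near (additionalLengthComplex P Δ)
      (preferredVertex P Δ v w i) (preferredVertex P Δ v w (i + 1)) := by
  have hl := h.isLeftNormalForm_preferredWord v w
  rw [preferredVertex, preferredVertex, List.prod_take_succ _ _ hi, ← mul_assoc]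
  exact h.near_coset _ _ (.inl (hl.1 _ (List.getElem_mem hi)).1)

theorem preferredVertex_length (h : IsGarsideOrder P Δ) [Nontrivial G] (v w : Vertex Δ) :
    preferredVertex P Δ v w (preferredWord P Δ v w).length = w := by
  obtain ⟨k, hk, hk0, hkl⟩ := h.exists_preferredVertex_eq v w (coset_rep P Δ w)
  rw [hk _ le_rfl, inf_eq_left.2 hkl, coset_mul_zpow, coset_rep]

theorem connected (h : IsGarsideOrder P Δ) [Nontrivial G] :
    (additionalLengthComplex P Δ).Connected := by
  have : Nonempty (Vertex Δ) := ⟨coset Δ 1⟩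
  refine ⟨fun v w => ?_⟩
  have main : ∀ i ≤ (preferredWord P Δ v w).length,
      (additionalLengthComplex P Δ).Reachable v (preferredVertex P Δ v w i) := by
    intro i
    induction i with
    | zero => intro _; rw [preferredVertex_zero]
    | succ i ih =>
      intro hi
      exact (ih (by omega)).trans (h.near_preferredVertex_succ v w hi).reachable
  have := main _ le_rfl
  rwa [h.preferredVertex_length] at this

theorem near_near_of_absorb (h : IsGarsideOrder P Δ) [Nontrivial G] {p z q : G} (g : G)
    (hpz : p ≤ z) (hzq : z ≤ q) (hlo : ∀ r : ℤ, g * Δ ^ r ≤ q → g * Δ ^ r ≤ p)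
    (hhi : ∀ r : ℤ, p ≤ g * Δ ^ r → q ≤ g * Δ ^ r) :
    Near (additionalLengthComplex P Δ) (coset Δ p) (coset Δ z) ∧
      Near (additionalLengthComplex P Δ) (coset Δ z) (coset Δ q) :=
  ⟨h.near_of_absorb g hpz (fun r hr => hlo r (hr.trans hzq)) fun r hr => hzq.trans (hhi r hr),
    h.near_of_absorb g hzq (fun r hr => (hlo r hr).trans hpz) fun r hr => hhi r (hpz.trans hr)⟩

theorem near_of_isSimple (h : IsGarsideOrder P Δ) [Nontrivial G] {a m : G} (hm : IsSimple P Δ m)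
    (i : ℤ) : Near (additionalLengthComplex P Δ) (coset Δ a) (coset Δ (a * m ⊓ a * Δ ^ i)) ∧
      Near (additionalLengthComplex P Δ) (coset Δ (a * m)) (coset Δ (a * m ⊓ a * Δ ^ i)) := by
  have hnear := h.near_coset a m (.inl hm)
  rw [h.isSimple_iff] at hm
  rcases le_or_gt i 0 with hi | hi
  · have h1 : a * Δ ^ i ≤ a * m := by
      rw [h.mul_le_mul_left_iff]
      exact (h.zpow_mono hi).trans (by simpa using hm.1)
    rw [inf_eq_right.2 h1, coset_mul_zpow]
    exact ⟨.inl rfl, hnear.symm⟩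
  · have h1 : a * m ≤ a * Δ ^ i := by
      rw [h.mul_le_mul_left_iff]
      exact hm.2.trans (by simpa using h.zpow_mono (show 1 ≤ i from hi))
    rw [inf_eq_left.2 h1]
    exact ⟨hnear, .inl rfl⟩

/-- Up to a power of `Δ`, each of these meets is an end or lies between `a` and `a * m` in the
order, and whatever absorbs `m` also absorbs the two intermediate quotients. -/
theorem near_of_isAbsorbable (h : IsGarsideOrder P Δ) [Nontrivial G] {a m : G}
    (hm : IsAbsorbable P Δ m) (i : ℤ) :
    Near (additionalLengthComplex P Δ) (coset Δ a) (coset Δ (a * m ⊓ a * Δ ^ i)) ∧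
      Near (additionalLengthComplex P Δ) (coset Δ (a * m)) (coset Δ (a * m ⊓ a * Δ ^ i)) := by
  have hnear := h.near_coset a m (.inr hm)
  obtain ⟨h0, x, hinf, hsup⟩ := hm
  have hga : ∀ y, (a * x⁻¹)⁻¹ * (a * y) = x * y := fun y => by group
  have hlo : ∀ r : ℤ, a * x⁻¹ * Δ ^ r ≤ a * m ↔ a * x⁻¹ * Δ ^ r ≤ a * 1 := fun r => by
    rw [h.mul_zpow_le_iff_le_inf, h.mul_zpow_le_iff_le_inf, hga, hga, mul_one, hinf]
  have hhi : ∀ r : ℤ, a * m ≤ a * x⁻¹ * Δ ^ r ↔ a * 1 ≤ a * x⁻¹ * Δ ^ r := fun r => by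
    rw [h.le_mul_zpow_iff_sup_le, h.le_mul_zpow_iff_sup_le, hga, hga, mul_one, hsup]
  rw [mul_one] at hlo hhi
  rcases h0 with h0 | h0
  · have h1 : a ≤ a * m := h.le_mul_of_one_le a (by simpa using h.le_inf_iff.1 h0.ge)
    rcases le_or_gt 0 i with hi | hi
    · have := h.near_near_of_absorb (a * x⁻¹) (le_inf h1 (h.le_mul_zpow a hi)) inf_le_left
        (fun r => (hlo r).1) (fun r => (hhi r).2)
      exact ⟨this.1, this.2.symm⟩
    · have h2 : a * Δ ^ i ≤ a := by simpa using h.mul_zpow_mono a hi.le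
      rw [inf_eq_right.2 (h2.trans h1), coset_mul_zpow]
      exact ⟨.inl rfl, hnear.symm⟩
  · have h1 : a * m ≤ a := by
      have := h.sup_le_iff.1 h0.le
      rw [zpow_zero] at this
      simpa using (h.mul_le_mul_left_iff a).2 this
    rcases le_or_gt 0 i with hi | hi
    · rw [inf_eq_left.2 (h1.trans (h.le_mul_zpow a hi))]
      exact ⟨hnear, .inl rfl⟩
    -- Multiplying the meet by `Δ ^ (-i)` places it between `a * m` and `a`.
    · rw [← coset_mul_zpow (a * m ⊓ a * Δ ^ i) (-i), h.inf_mul_zpow, mul_assoc a (Δ ^ i),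
        ← zpow_add, add_neg_cancel, zpow_zero, mul_one]
      have := h.near_near_of_absorb (a * x⁻¹) (le_inf (h.le_mul_zpow (a * m) (k := -i) (by omega))
        h1) inf_le_right (fun r => (hlo r).2) (fun r => (hhi r).1)
      exact ⟨this.2.symm, this.1⟩

theorem isSlimPathSystem (h : IsGarsideOrder P Δ) [Nontrivial G] :
    MetricGraph.IsSlimPathSystem (additionalLengthComplex P Δ) (preferredVertex P Δ)
      (fun v w => (preferredWord P Δ v w).length) where
  connected := h.connected
  apply_zero := preferredVertex_zero
  apply_len := h.preferredVertex_length
  dist_succ_le v w i hi := (h.near_preferredVertex_succ v w hi).dist_le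
  mem_subpath v w i l j hil hlj hj := by
    obtain ⟨k, hk, -, -⟩ := h.exists_preferredVertex_eq v w (coset_rep P Δ w)
    rw [h.mem_pathSet_iff (hk i (by omega)).symm (hk j hj).symm, hk l (by omega)]
    -- With `a` and `b` suitable representatives of `v` and `w`, the claim is `(b ⊓ a * Δ ^ j) ⊓ (b
    -- ⊓ a * Δ ^ i) * Δ ^ (l - i) = b ⊓ a * Δ ^ l`.
    refine ⟨l - i, congrArg _ ?_⟩
    rw [h.inf_mul_zpow, mul_assoc (rep P Δ v), ← zpow_add, add_sub_cancel]
    apply le_antisymm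
    · exact le_inf (inf_le_inf_left _ (h.mul_zpow_mono _ (by exact_mod_cast hlj)))
        (inf_le_inf_right _ (h.le_mul_zpow _ (by omega)))
    · exact le_inf (inf_le_left.trans inf_le_left) (inf_le_right.trans inf_le_right)
  slim u v w x hx := by
    obtain ⟨a, rfl⟩ := QuotientGroup.mk_surjective u
    obtain ⟨b, rfl⟩ := QuotientGroup.mk_surjective w
    obtain ⟨c, rfl⟩ := QuotientGroup.mk_surjective v
    obtain ⟨i, rfl⟩ := (h.mem_pathSet_iff (a := a) (b := b) rfl rfl).1 hx
    obtain ⟨k, z, hz, y, h1, h2⟩ := h.exists_near_near (a * Δ ^ i) b c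
    refine ⟨z, ?_, ?_⟩
    · rcases hz with rfl | rfl
      · refine .inl ((h.mem_pathSet_iff (a := a) rfl (coset_mul_zpow c k)).2 ⟨i, ?_⟩)
        rw [inf_comm]
      · exact .inr ((h.mem_pathSet_iff (a := c) rfl rfl).2 ⟨k, rfl⟩)
    · rw [inf_comm]
      have h3 := h1.dist_le
      have h4 := h2.dist_le
      have h5 := h.connected.dist_triangle (u := coset Δ (a * Δ ^ i ⊓ b)) (v := y) (w := z)
      omega
  dist_le_of_dist_le_one v w hvw x hx := by
    have main : ∀ v w : Vertex Δ, ((∃ m, IsSimple P Δ m ∧ m ≠ 1 ∧ m ≠ Δ ∧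
        coset Δ (rep P Δ v * m) = w) ∨ ∃ y, IsAbsorbable P Δ y ∧ coset Δ (rep P Δ v * y) = w) →
        ∀ i : ℤ, Near (additionalLengthComplex P Δ) v
          (coset Δ (rep P Δ w ⊓ rep P Δ v * Δ ^ i)) ∧ Near (additionalLengthComplex P Δ) w
          (coset Δ (rep P Δ w ⊓ rep P Δ v * Δ ^ i)) := by
      intro v w hr i
      have key : ∃ m, (IsSimple P Δ m ∨ IsAbsorbable P Δ m) ∧ coset Δ (rep P Δ v * m) = w := by
        rcases hr with ⟨m, hm, -, -, hw⟩ | ⟨m, hm, hw⟩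
        · exact ⟨m, .inl hm, hw⟩
        · exact ⟨m, .inr hm, hw⟩
      obtain ⟨m, hm, hw⟩ := key
      obtain ⟨k, hk⟩ := coset_eq_iff.1 (hw.trans (coset_rep P Δ w).symm)
      have hx : coset Δ (rep P Δ w ⊓ rep P Δ v * Δ ^ i) =
          coset Δ (rep P Δ v * m ⊓ rep P Δ v * Δ ^ (i - k)) := by
        rw [← coset_mul_zpow (rep P Δ v * m ⊓ _) k, h.inf_mul_zpow, ← hk, mul_assoc _ (Δ ^ (i - k)),
          ← zpow_add, sub_add_cancel]
      rw [hx]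
      have := hm.elim (fun hm => h.near_of_isSimple (a := rep P Δ v) hm (i - k))
        (fun hm => h.near_of_isAbsorbable (a := rep P Δ v) hm (i - k))
      rwa [hw, coset_rep] at this
    obtain ⟨i, rfl⟩ := (h.mem_pathSet_iff (coset_rep P Δ v) (coset_rep P Δ w)).1 hx
    rcases eq_or_ne v w with rfl | hne
    · refine Near.dist_le (.inl ?_)
      rcases le_total 0 i with hi | hi
      · rw [inf_eq_left.2 (h.le_mul_zpow _ hi), coset_rep]
      · have := h.mul_zpow_mono (rep P Δ v) hi
        rw [zpow_zero, mul_one] at this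
        rw [inf_eq_right.2 this, coset_mul_zpow, coset_rep]
    · have hpos := h.connected.pos_dist_of_ne hne
      have hadj := SimpleGraph.dist_eq_one_iff_adj.1 (le_antisymm hvw hpos)
      obtain ⟨-, hr | hr⟩ := hadj
      · exact (main v w hr i).1.dist_le
      -- If the edge relation holds from `w` to `v`, the exponent `-i` gives the same coset after
      -- multiplication by `Δ ^ i`.
      · have := (main w v hr (-i)).2.dist_le
        rwa [← coset_mul_zpow _ i, h.inf_mul_zpow, mul_assoc (rep P Δ w), ← zpow_add,
          neg_add_cancel, zpow_zero, mul_one, inf_comm] at this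

end IsGarsideOrder

/-- The preferred paths of a Garside group form a path system with `2`-slim triangles. -/
theorem IsGarsideGroup.isSlimPathSystem (h : IsGarsideGroup P Δ) :
    MetricGraph.IsSlimPathSystem (additionalLengthComplex P Δ) (preferredVertex P Δ)
      (fun v w => (preferredWord P Δ v w).length) := by
  -- In the trivial group infima are default values and `le_inf_iff` fails, but there the complex is
  -- a single vertex.
  rcases subsingleton_or_nontrivial G with hG | hG
  · have : Subsingleton (Vertex Δ) := Quotient.instSubsingletonQuotient _
    have : Nonempty (Vertex Δ) := ⟨coset Δ 1⟩
    have hdist : ∀ v w, (additionalLengthComplex P Δ).dist v w = 0 := fun v w => by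
      rw [Subsingleton.elim v w, SimpleGraph.dist_self]
    exact
      { connected := ⟨fun v w => by rw [Subsingleton.elim v w]⟩
        apply_zero := fun _ _ => Subsingleton.elim _ _
        apply_len := fun _ _ => Subsingleton.elim _ _
        dist_succ_le := fun _ _ _ _ => by rw [hdist]; exact zero_le_one
        mem_subpath := fun _ _ _ _ _ _ _ _ => ⟨0, Nat.zero_le _, Subsingleton.elim _ _⟩
        slim := fun _ _ _ x _ => ⟨x, .inl ⟨0, Nat.zero_le _, Subsingleton.elim _ _⟩, by simp⟩
        dist_le_of_dist_le_one := fun _ _ _ _ _ => by rw [hdist]; exact zero_le_one }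
  · let _ := h.semilatticeInf
    exact IsGarsideOrder.isSlimPathSystem ⟨h, fun _ _ => Iff.rfl⟩

end PreferredPaths

end Garside

theorem theorem2 :
    ∃ K C : ℝ, 1 ≤ K ∧ 0 ≤ C ∧
      ∀ (G : Type*) [Group G] (P : Submonoid G) (Δ : G), Garside.IsGarsideGroup P Δ →
        MetricGraph.IsHyperbolic (Garside.additionalLengthComplex P Δ) 60 ∧
        (∀ (v w : Garside.Vertex Δ)
          (S : Set (MetricGraph.Point (Garside.additionalLengthComplex P Δ))),
          MetricGraph.IsGeodesicSegment S
            (MetricGraph.vertex (Garside.additionalLengthComplex P Δ) v)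
            (MetricGraph.vertex (Garside.additionalLengthComplex P Δ) w) →
          MetricGraph.IsInNeighborhood 39 (Garside.preferredPath P Δ v w) S ∧
            MetricGraph.IsInNeighborhood 39 S (Garside.preferredPath P Δ v w)) ∧
        ∀ v w : Garside.Vertex Δ,
          MetricGraph.IsUnparametrizedQuasiGeodesic (Garside.additionalLengthComplex P Δ) K C
            (Garside.preferredVertex P Δ v w) (Garside.preferredWord P Δ v w).length := by
  refine ⟨1, 104, le_rfl, by norm_num, fun G _ P Δ h => ?_⟩
  have hf := h.isSlimPathSystem
  exact ⟨hf.isHyperbolic, fun v w S hS => hf.isInNeighborhood_geodesic hS,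
    fun v w => hf.isUnparametrizedQuasiGeodesic v w⟩
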